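/- Let $M_4(\mathbb C)$ be the algebra of $4\times 4$ complex matrices and $\tau=\frac14\mathrm{Tr}$ its normalized trace. By a subalgebra we mean a unital $*$-subalgebra, containing the identity $I$ of $M_4(\mathbb C)$. Two subalgebras $\mathcal A,\mathcal B$ are complementary if $\tau(AB)=\tau(A)\tau(B)$ for all $A\in\mathcal A$, $B\in\mathcal B$; equivalently, $\mathcal A\ominus\mathbb C I$ and $\mathcal B\ominus\mathbb C I$ are orthogonal in the Hilbert–Schmidt inner product. An F-subalgebra is a subalgebra $*$-isomorphic to $M_2(\mathbb C)$; an M-subalgebra is a maximal Abelian $*$-subalgebra. Theorem. Let $\mathcal A_k$ ($0\le k\le 4$) be pairwise complementary subalgebras of $M_4(\mathbb C)$, each of which is an F-subalgebra or an M-subalgebra, and let $\ell$ be the number of F-subalgebras among them. Then $\ell\in\{0,2,4\}$. Conversely, for each $\ell\in\{0,2,4\}$ there are five such subalgebras of which exactly $\ell$ are F-subalgebras, and they can be chosen so that each of them is the linear span of a set of Pauli products $\sigma_i\otimes\sigma_j$ ($0\le i,j\le 3$), where $\sigma_0$ is the $2\times2$ identity, $\sigma_1,\sigma_2,\sigma_3$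 are the Pauli matrices, and $M_4(\mathbb C)=M_2(\mathbb C)\otimes M_2(\mathbb C)$. -/

import Mathlib

open scoped Kronecker

/-- `τ = Tr / n`, the normalized trace on `n × n` complex matrices. -/
noncomputable def normTrace {n : ℕ} (X : Matrix (Fin n) (Fin n) ℂ) : ℂ :=
  X.trace / (n : ℂ)

/-- Two unital `*`-subalgebras of `M_n(ℂ)` are complementary (quasi-orthogonal) if
`τ(XY) = τ(X) τ(Y)` for all `X` in the first one and all `Y` in the second one. -/
def IsComplementary {n : ℕ} (A B : StarSubalgebra ℂ (Matrix (Fin n) (Fin n) ℂ)) : Prop :=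
  ∀ X ∈ A, ∀ Y ∈ B, normTrace (X * Y) = normTrace X * normTrace Y

/-- An F-subalgebra of `M_4(ℂ)`: a unital `*`-subalgebra isomorphic to `M_2(ℂ)`. -/
def IsFSubalgebra (A : StarSubalgebra ℂ (Matrix (Fin 4) (Fin 4) ℂ)) : Prop :=
  Nonempty (A ≃⋆ₐ[ℂ] Matrix (Fin 2) (Fin 2) ℂ)

/-- An M-subalgebra of `M_4(ℂ)`: a maximal Abelian `*`-subalgebra. -/
def IsMSubalgebra (A : StarSubalgebra ℂ (Matrix (Fin 4) (Fin 4) ℂ)) : Prop :=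
  Maximal (fun B : StarSubalgebra ℂ (Matrix (Fin 4) (Fin 4) ℂ) =>
    ∀ X ∈ B, ∀ Y ∈ B, X * Y = Y * X) A

/-- Five pairwise complementary subalgebras of `M_4(ℂ)`, each of which is an F-subalgebra
or an M-subalgebra. -/
def IsComplementaryDecomposition
    (A : Fin 5 → StarSubalgebra ℂ (Matrix (Fin 4) (Fin 4) ℂ)) : Prop :=
  (∀ k, IsFSubalgebra (A k) ∨ IsMSubalgebra (A k)) ∧
    Pairwise (fun j k => IsComplementary (A j) (A k))

/-- The Pauli matrices, `σ_0` being the identity. -/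
noncomputable def pauli : Fin 4 → Matrix (Fin 2) (Fin 2) ℂ :=
  ![!![1, 0; 0, 1], !![0, 1; 1, 0], !![0, -Complex.I; Complex.I, 0], !![1, 0; 0, -1]]

/-- The Pauli product `σ_i ⊗ σ_j` as a `4 × 4` matrix, in the standard product basis
`|00⟩, |01⟩, |10⟩, |11⟩`. -/
noncomputable def pauliProd (i j : Fin 4) : Matrix (Fin 4) (Fin 4) ℂ :=
  Matrix.reindex (finProdFinEquiv (m := 2) (n := 2)) (finProdFinEquiv (m := 2) (n := 2))
    (pauli i ⊗ₖ pauli j)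

/-- The subalgebra is the linear span of a set of Pauli products. -/
def IsPauliSpanned (A : StarSubalgebra ℂ (Matrix (Fin 4) (Fin 4) ℂ)) : Prop :=
  ∃ S : Set (Fin 4 × Fin 4),
    Subalgebra.toSubmodule A.toSubalgebra =
      Submodule.span ℂ ((fun p : Fin 4 × Fin 4 => pauliProd p.1 p.2) '' S)

/-! The traceless part of $M_4(\mathbb C)$ has dimension 15, and each of the five algebras supplies
a trace-orthogonal triple of it. With the identity these triples form a complete basis, so $\sum e X
e = 4\,\mathrm{Tr}(X) I$ (`sum_mul_mul_of_trace_orthogonal`). Put $T_k(X) = X + \sum_i e_{k,i} X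
e_{k,i}$ (`twirl`); for traceless $X$ this becomes $\sum_k T_k(X) = 4X$ (`sum_twirl`). For an
M-subalgebra, $T_k$ kills everything orthogonal to $\mathcal A_k$. For an F-subalgebra, $T_k$ is
four times the projection onto the commutant and kills the traceless part of $\mathcal A_k$. So on
the traceless part of an F-subalgebra $\mathcal A_j$, the sum of $T_k$ over the other F-subalgebras
alone is already $4X$; this excludes $\ell = 1$ at once.

The other ingredient is `exists_involution_commuting`: of two complementary F-subalgebras, the first
contains a traceless Hermitian unitary $p$ commuting with the second, so that $T_k(p) = 4p$. If
$\ell = 3$, one algebra contains such $p, q$ for the other two; each is killed by the other's twirl,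
and applying the resolution to the traceless part of $pq$ forces $pq = 0$, which is absurd. If $\ell
= 5$, one algebra contains four such involutions; positivity of the twirls makes them pairwise
orthogonal, while the traceless part of $M_2(\mathbb C)$ has dimension three.

For the converse, Pauli products modulo phases form $(\mathbb Z/2)^4$. A partition of its nonzero
elements into five subgroups of order four gives a decomposition, a subgroup spanning an M- or
F-subalgebra according to whether its Pauli products commute. -/

/-! ### Completeness of a trace-orthogonal basis -/

/-- A trace-orthogonal basis of Hermitian `4 × 4` matrices resolves the trace. -/
theorem sum_mul_mul_of_trace_orthogonal {ι : Type*} [Fintype ι] [DecidableEq ι]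
    (hι : Fintype.card ι = 16) (e : ι → Matrix (Fin 4) (Fin 4) ℂ)
    (he : ∀ i j, (e i * e j).trace = if i = j then 4 else 0) (X : Matrix (Fin 4) (Fin 4) ℂ) :
    ∑ i, e i * X * e i = (4 * X.trace) • (1 : Matrix (Fin 4) (Fin 4) ℂ) := by
  let W : Matrix ι (Fin 4 × Fin 4) ℂ := Matrix.of fun i p => e i p.1 p.2
  let W' : Matrix (Fin 4 × Fin 4) ι ℂ := Matrix.of fun p i => e i p.2 p.1 / 4
  have h1 : W * W' = 1 := by
    ext i j
    have := he i j
    simp only [Matrix.trace, Matrix.diag, Matrix.mul_apply] at this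
    simp only [W, W', Matrix.mul_apply, Matrix.of_apply, Fintype.sum_prod_type, mul_div_assoc',
      ← Finset.sum_div, this, Matrix.one_apply]
    split_ifs <;> simp
  -- `W` is square up to reindexing since both index types have 16 elements, so orthogonality gives
  -- completeness; `h3` is its entrywise form.
  have h2 : W' * W = 1 :=
    (Matrix.mul_eq_one_comm_of_card_eq _ _ _ (by simp [hι])).1 h1
  have h3 : ∀ a b c d, ∑ i, e i b a * e i c d = if a = c ∧ b = d then 4 else 0 := by
    intro a b c d
    have := congrFun (congrFun h2 (a, b)) (c, d)
    simp only [W, W', Matrix.mul_apply, Matrix.of_apply, Matrix.one_apply, Prod.mk.injEq,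
      div_mul_eq_mul_div, ← Finset.sum_div] at this
    rw [div_eq_iff (by norm_num)] at this
    rw [this]
    split_ifs <;> simp
  ext x y
  calc (∑ i, e i * X * e i) x y
      = ∑ k, ∑ j, X j k * ∑ i, e i x j * e i k y := by
        simp only [Matrix.sum_apply, Matrix.mul_apply, Finset.sum_mul, Finset.mul_sum]
        rw [Finset.sum_comm]
        refine Finset.sum_congr rfl fun k _ => ?_
        rw [Finset.sum_comm]
        exact Finset.sum_congr rfl fun j _ => Finset.sum_congr rfl fun i _ => by ring
    _ = _ := by
        simp only [h3]
        by_cases hxy : x = y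
        · subst hxy
          simp [Matrix.trace, Matrix.diag, Finset.mul_sum, mul_comm]
        · simp [hxy]

/-! ### Commutative subalgebras and diagonalization -/

/-- A commutative `*`-subalgebra of a complex matrix algebra is simultaneously diagonalizable. -/
theorem exists_unitary_isDiag_of_commutative {n : ℕ}
    (B : StarSubalgebra ℂ (Matrix (Fin n) (Fin n) ℂ)) (hB : ∀ X ∈ B, ∀ Y ∈ B, X * Y = Y * X) :
    ∃ U : Matrix (Fin n) (Fin n) ℂ, U.conjTranspose * U = 1 ∧ U * U.conjTranspose = 1 ∧
      ∀ X ∈ B, (U.conjTranspose * X * U).IsDiag := by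
  classical
  -- Only Hermitian elements are diagonalized directly, through joint eigenspaces of commuting
  -- symmetric operators; a general `X` is then split into Hermitian parts.
  let T : {X : Matrix (Fin n) (Fin n) ℂ // X ∈ B ∧ X.IsHermitian} →
      Module.End ℂ (EuclideanSpace ℂ (Fin n)) := fun X => Matrix.toEuclideanLin X.1
  have hT : ∀ i, (T i).IsSymmetric := fun i => Matrix.isSymmetric_toEuclideanLin_iff.2 i.2.2
  have hC : Pairwise (Function.onFun Commute T) := by
    intro i j _
    have h := hB i.1 i.2.1 j.1 j.2.1
    ext v k
    have := congrArg (fun M => (M.mulVec v.ofLp) k) h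
    simpa [T, Matrix.toLpLin_apply, Matrix.mulVec_mulVec] using this
  have hO := LinearMap.IsSymmetric.orthogonalFamily_iInf_eigenspaces hT
  have hI := LinearMap.IsSymmetric.directSum_isInternal_of_pairwise_commute hT hC
  rw [← DirectSum.isInternal_ne_bot_iff] at hI
  have hfin : Finite {χ : {X : Matrix (Fin n) (Fin n) ℂ // X ∈ B ∧ X.IsHermitian} → ℂ //
      (⨅ j, Module.End.eigenspace (T j) (χ j)) ≠ ⊥} :=
    WellFoundedGT.finite_ne_bot_of_iSupIndep hO.independent
  have := Fintype.ofFinite {χ : {X : Matrix (Fin n) (Fin n) ℂ // X ∈ B ∧ X.IsHermitian} → ℂ //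
      (⨅ j, Module.End.eigenspace (T j) (χ j)) ≠ ⊥}
  have hO' := hO.comp (Subtype.val_injective
    (p := fun χ => (⨅ j, Module.End.eigenspace (T j) (χ j)) ≠ ⊥))
  let b := hI.subordinateOrthonormalBasis (n := n) (by simp) hO'
  let χ := fun a => (hI.subordinateOrthonormalBasisIndex (n := n) (by simp) a hO').1
  have hb : ∀ a j, T j (b a) = χ a j • b a := by
    intro a j
    have := hI.subordinateOrthonormalBasis_subordinate (n := n) (by simp) a hO'
    exact Module.End.mem_eigenspace_iff.1 ((Submodule.mem_iInf _).1 this j)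
  let U : Matrix (Fin n) (Fin n) ℂ := Matrix.of fun i a => b a i
  have hU : U.conjTranspose * U = 1 := by
    ext i j
    have := orthonormal_iff_ite.mp b.orthonormal i j
    simpa [U, Matrix.mul_apply, Matrix.one_apply, PiLp.inner_apply, mul_comm] using this
  have hdiag : ∀ X, X ∈ B → X.IsHermitian → (U.conjTranspose * X * U).IsDiag := by
    intro X hX hXh i j hij
    have h1 : X * U = U * Matrix.diagonal (fun a => χ a ⟨X, hX, hXh⟩) := by
      ext k a
      have := congrArg (fun v : EuclideanSpace ℂ (Fin n) => v k) (hb a ⟨X, hX, hXh⟩)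
      rw [Matrix.mul_diagonal, mul_comm]
      simpa [T, Matrix.toLpLin_apply, Matrix.mulVec, dotProduct, U, Matrix.mul_apply] using this
    rw [mul_assoc, h1, ← mul_assoc, hU, one_mul, Matrix.diagonal_apply_ne _ hij]
  refine ⟨U, hU, mul_eq_one_comm.1 hU, fun X hX => ?_⟩
  have hs : star X ∈ B := star_mem hX
  have e : X = (1 / 2 : ℂ) • (X + star X) + (-Complex.I / 2) • (Complex.I • (X - star X)) := by
    rw [smul_smul, show -Complex.I / 2 * Complex.I = 1 / 2 by
      linear_combination (-1 / 2 : ℂ) * Complex.I_mul_I]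
    module
  have h1 := hdiag (X + star X) (add_mem hX hs) (by
    simp [Matrix.IsHermitian, Matrix.star_eq_conjTranspose, add_comm])
  have h2 := hdiag (Complex.I • (X - star X))
    ((B.smul_mem (sub_mem hX hs) _)) (by
    simp only [Matrix.IsHermitian, Matrix.star_eq_conjTranspose, Matrix.conjTranspose_smul,
      Matrix.conjTranspose_sub, Matrix.conjTranspose_conjTranspose, RCLike.star_def, Complex.conj_I]
    module)
  rw [e, mul_add, add_mul, mul_smul_comm, smul_mul_assoc, mul_smul_comm, smul_mul_assoc]
  exact (h1.smul _).add (h2.smul _)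

/-- The `*`-subalgebra of the matrices which a unitary matrix `U` diagonalizes. -/
def diagonalizedBy {n : ℕ} (U : Matrix (Fin n) (Fin n) ℂ) (h : U.conjTranspose * U = 1)
    (h' : U * U.conjTranspose = 1) : StarSubalgebra ℂ (Matrix (Fin n) (Fin n) ℂ) where
  carrier := {X | (U.conjTranspose * X * U).IsDiag}
  mul_mem' {X Y} hX hY := by
    have e : U.conjTranspose * (X * Y) * U =
        (U.conjTranspose * X * U) * (U.conjTranspose * Y * U) := by
      calc _ = U.conjTranspose * X * 1 * Y * U := by simp only [mul_one, mul_assoc]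
        _ = _ := by rw [← h']; simp only [mul_assoc]
    rw [Set.mem_ofPred_eq, e, ← (Matrix.isDiag_iff_diagonal_diag _).1 hX,
      ← (Matrix.isDiag_iff_diagonal_diag _).1 hY, Matrix.diagonal_mul_diagonal]
    exact Matrix.isDiag_diagonal _
  add_mem' {X Y} hX hY := by
    rw [Set.mem_ofPred_eq, mul_add, add_mul]
    exact Matrix.IsDiag.add hX hY
  algebraMap_mem' r := by
    rw [Set.mem_ofPred_eq, Algebra.algebraMap_eq_smul_one, mul_smul_comm, smul_mul_assoc, mul_one, h]
    exact Matrix.isDiag_one.smul r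
  star_mem' {X} hX := by
    have e : U.conjTranspose * star X * U = (U.conjTranspose * X * U).conjTranspose := by
      simp [Matrix.star_eq_conjTranspose, mul_assoc]
    rw [Set.mem_ofPred_eq, e]
    exact Matrix.IsDiag.conjTranspose hX

theorem mem_diagonalizedBy {n : ℕ} {U : Matrix (Fin n) (Fin n) ℂ} {h : U.conjTranspose * U = 1}
    {h' : U * U.conjTranspose = 1} {X : Matrix (Fin n) (Fin n) ℂ} :
    X ∈ diagonalizedBy U h h' ↔ (U.conjTranspose * X * U).IsDiag := Iff.rfl

theorem eq_mul_diagonal_mul {n : ℕ} {U : Matrix (Fin n) (Fin n) ℂ}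
    (h' : U * U.conjTranspose = 1) {X : Matrix (Fin n) (Fin n) ℂ}
    (hX : (U.conjTranspose * X * U).IsDiag) :
    X = U * Matrix.diagonal (U.conjTranspose * X * U).diag * U.conjTranspose := by
  rw [(Matrix.isDiag_iff_diagonal_diag _).1 hX]
  calc X = 1 * X * 1 := by simp
    _ = _ := by rw [← h']; simp only [mul_assoc]

theorem mul_diagonal_mul_mem_diagonalizedBy {n : ℕ} {U : Matrix (Fin n) (Fin n) ℂ}
    (h : U.conjTranspose * U = 1) (h' : U * U.conjTranspose = 1) (d : Fin n → ℂ) :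
    U * Matrix.diagonal d * U.conjTranspose ∈ diagonalizedBy U h h' := by
  have e : U.conjTranspose * (U * Matrix.diagonal d * U.conjTranspose) * U = Matrix.diagonal d := by
    calc _ = (U.conjTranspose * U) * Matrix.diagonal d * (U.conjTranspose * U) := by
          simp only [mul_assoc]
      _ = _ := by simp [h]
  rw [mem_diagonalizedBy, e]
  exact Matrix.isDiag_diagonal d

theorem conj_diagonal_mul {n : ℕ} {U : Matrix (Fin n) (Fin n) ℂ}
    (h : U.conjTranspose * U = 1) (d d' : Fin n → ℂ) :
    (U * Matrix.diagonal d * U.conjTranspose) * (U * Matrix.diagonal d' * U.conjTranspose) =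
      U * Matrix.diagonal (fun i => d i * d' i) * U.conjTranspose := by
  calc _ = U * Matrix.diagonal d * (U.conjTranspose * U) * Matrix.diagonal d' * U.conjTranspose := by
        simp only [mul_assoc]
    _ = _ := by rw [h, mul_one, mul_assoc U, Matrix.diagonal_mul_diagonal]

theorem diagonalizedBy_commutative {n : ℕ} {U : Matrix (Fin n) (Fin n) ℂ}
    (h : U.conjTranspose * U = 1) (h' : U * U.conjTranspose = 1) :
    ∀ X ∈ diagonalizedBy U h h', ∀ Y ∈ diagonalizedBy U h h', X * Y = Y * X := by
  intro X hX Y hY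
  rw [eq_mul_diagonal_mul h' hX, eq_mul_diagonal_mul h' hY, conj_diagonal_mul h,
    conj_diagonal_mul h]
  simp only [mul_comm]

/-- A maximal Abelian `*`-subalgebra consists of the matrices diagonalized by some unitary. -/
theorem IsMSubalgebra.exists_eq_diagonalizedBy
    {A : StarSubalgebra ℂ (Matrix (Fin 4) (Fin 4) ℂ)} (hA : IsMSubalgebra A) :
    ∃ (U : Matrix (Fin 4) (Fin 4) ℂ) (h : U.conjTranspose * U = 1)
      (h' : U * U.conjTranspose = 1), A = diagonalizedBy U h h' := by
  obtain ⟨U, h, h', hU⟩ := exists_unitary_isDiag_of_commutative A hA.prop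
  exact ⟨U, h, h', hA.eq_of_le (diagonalizedBy_commutative h h') fun X hX => hU X hX⟩

/-- A commutative `*`-subalgebra of `M_4(ℂ)` of dimension four is maximal Abelian. -/
theorem isMSubalgebra_of_finrank_eq_four {A : StarSubalgebra ℂ (Matrix (Fin 4) (Fin 4) ℂ)}
    (hA : ∀ X ∈ A, ∀ Y ∈ A, X * Y = Y * X)
    (hd : Module.finrank ℂ (Subalgebra.toSubmodule A.toSubalgebra) = 4) : IsMSubalgebra A := by
  refine ⟨hA, fun B hB hAB => ?_⟩
  obtain ⟨U, h, h', hU⟩ := exists_unitary_isDiag_of_commutative B hB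
  -- Any commutative `B` containing `A` lies in a unitary conjugate of the diagonal matrices, hence
  -- has dimension at most four.
  let f : (Fin 4 → ℂ) →ₗ[ℂ] Matrix (Fin 4) (Fin 4) ℂ :=
    LinearMap.mulRight ℂ U.conjTranspose ∘ₗ LinearMap.mulLeft ℂ U ∘ₗ
      Matrix.diagonalLinearMap (Fin 4) ℂ ℂ
  have h1 : Subalgebra.toSubmodule B.toSubalgebra ≤ LinearMap.range f := fun X hX =>
    ⟨(U.conjTranspose * X * U).diag, (eq_mul_diagonal_mul h' (hU X hX)).symm⟩
  have h2 : Module.finrank ℂ (Subalgebra.toSubmodule B.toSubalgebra) ≤ 4 :=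
    (Submodule.finrank_mono h1).trans ((LinearMap.finrank_range_le f).trans (by simp))
  have h3 : Subalgebra.toSubmodule A.toSubalgebra = Subalgebra.toSubmodule B.toSubalgebra :=
    Submodule.eq_of_le_of_finrank_le (fun X hX => hAB hX) (h2.trans hd.ge)
  intro X hX
  have : X ∈ Subalgebra.toSubmodule A.toSubalgebra := h3 ▸ hX
  exact this

/-- The characters of the Klein four-group. -/
def kleinSign : Fin 4 → Fin 4 → ℂ :=
  ![![1, 1, 1, 1], ![1, 1, -1, -1], ![1, -1, 1, -1], ![1, -1, -1, 1]]

/-- A trace-orthogonal Hermitian basis `1, e 0, e 1, e 2` of `A`, such that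
`X ↦ X + ∑ e i * X * e i` vanishes on the orthogonal complement of `A`. -/
theorem IsMSubalgebra.exists_basis
    {A : StarSubalgebra ℂ (Matrix (Fin 4) (Fin 4) ℂ)} (hA : IsMSubalgebra A) :
    ∃ e : Fin 3 → Matrix (Fin 4) (Fin 4) ℂ, (∀ i, e i ∈ A) ∧ (∀ i, (e i).trace = 0) ∧
      (∀ i j, (e i * e j).trace = if i = j then 4 else 0) ∧
      ∀ X, (∀ Y ∈ A, (Y * X).trace = 0) → X + ∑ i, e i * X * e i = 0 := by
  obtain ⟨U, h, h', rfl⟩ := hA.exists_eq_diagonalizedBy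
  have htr : ∀ d, (U * Matrix.diagonal d * U.conjTranspose).trace = ∑ i, d i := by
    intro d
    rw [Matrix.trace_mul_comm, ← mul_assoc, h, one_mul, Matrix.trace_diagonal]
  refine ⟨fun i => U * Matrix.diagonal (kleinSign i.succ) * U.conjTranspose,
    fun i => mul_diagonal_mul_mem_diagonalizedBy h h' _, fun i => ?_, fun i j => ?_, fun X hX => ?_⟩
  · rw [htr]
    fin_cases i <;> simp [kleinSign, Fin.sum_univ_four]
  · rw [conj_diagonal_mul h, htr]
    fin_cases i <;> fin_cases j <;> simp [kleinSign, Fin.sum_univ_four] <;> norm_num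
  · let Z := U.conjTranspose * X * U
    have hZ : ∀ a, Z a a = 0 := by
      intro a
      have := hX _ (mul_diagonal_mul_mem_diagonalizedBy h h' (Pi.single a 1))
      rw [mul_assoc, mul_assoc, Matrix.trace_mul_comm, mul_assoc, mul_assoc] at this
      rw [← mul_assoc U.conjTranspose X U] at this
      simpa [Z, Matrix.trace, Matrix.diagonal_mul, Pi.single_apply] using this
    have hX' : X = U * Z * U.conjTranspose := by
      calc X = 1 * X * 1 := by simp
        _ = _ := by rw [← h']; simp only [Z, mul_assoc]
    -- Orthogonality of the columns of `kleinSign`: the map multiplies the entry `(a, b)` by 4 if `a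
    -- = b` and by 0 otherwise, and `Z` has zero diagonal.
    have key : Z + ∑ i : Fin 3, Matrix.diagonal (kleinSign i.succ) * Z *
        Matrix.diagonal (kleinSign i.succ) = 0 := by
      ext a b
      simp only [Fin.sum_univ_three, Matrix.add_apply, Matrix.diagonal_mul, Matrix.mul_diagonal]
      by_cases hab : a = b
      · subst hab
        simp [hZ]
      · fin_cases a <;> fin_cases b <;> simp [kleinSign] at hab ⊢
    have hc : ∀ d, U * Matrix.diagonal d * U.conjTranspose * X *
        (U * Matrix.diagonal d * U.conjTranspose) =
        U * (Matrix.diagonal d * Z * Matrix.diagonal d) * U.conjTranspose := by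
      intro d
      simp only [Z, mul_assoc]
    simp only [hc]
    nth_rewrite 1 [hX']
    rw [← Finset.sum_mul, ← Finset.mul_sum, ← add_mul, ← mul_add, key]
    simp

/-! ### F-subalgebras as a tensor factor -/

theorem IsFSubalgebra.exists_starAlgHom {A : StarSubalgebra ℂ (Matrix (Fin 4) (Fin 4) ℂ)}
    (hA : IsFSubalgebra A) : ∃ φ : Matrix (Fin 2) (Fin 2) ℂ →⋆ₐ[ℂ] Matrix (Fin 4) (Fin 4) ℂ,
      ∀ X, X ∈ A ↔ ∃ a, φ a = X := by
  obtain ⟨e⟩ := hA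
  refine ⟨A.subtype.comp (e.symm : Matrix (Fin 2) (Fin 2) ℂ →⋆ₐ[ℂ] A), fun X => ⟨fun hX => ?_, ?_⟩⟩
  · exact ⟨e ⟨X, hX⟩, by simp⟩
  · rintro ⟨a, rfl⟩
    exact (e.symm a).2

/-- The trace composed with `φ` is a tracial functional on $M_2(\mathbb C)$, hence a multiple of the
trace; the value 4 at the identity fixes the factor 2. -/
theorem trace_starAlgHom (φ : Matrix (Fin 2) (Fin 2) ℂ →⋆ₐ[ℂ] Matrix (Fin 4) (Fin 4) ℂ)
    (a : Matrix (Fin 2) (Fin 2) ℂ) : (φ a).trace = 2 * a.trace := by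
  have comm : ∀ a b, (φ (a * b)).trace = (φ (b * a)).trace := fun a b => by
    rw [map_mul, map_mul, Matrix.trace_mul_comm]
  have h01 := comm !![0, 1; 0, 0] !![0, 0; 0, 1]
  have h10 := comm !![0, 0; 1, 0] !![1, 0; 0, 0]
  have h11 := comm !![0, 1; 0, 0] !![0, 0; 1, 0]
  have h1 : (φ 1).trace = 4 := by simp
  simp only [Matrix.mul_fin_two, mul_zero, mul_one, add_zero, zero_add] at h01 h10 h11
  have e0 : !![(0 : ℂ), 0; 0, 0] = 0 := by ext i j; fin_cases i <;> fin_cases j <;> rfl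
  have e1 : (1 : Matrix (Fin 2) (Fin 2) ℂ) = !![1, 0; 0, 0] + !![0, 0; 0, 1] := by
    ext i j; fin_cases i <;> fin_cases j <;> simp
  rw [e0, map_zero, Matrix.trace_zero] at h01 h10
  rw [e1, map_add, Matrix.trace_add] at h1
  have ea : a = a 0 0 • !![1, 0; 0, 0] + a 0 1 • !![0, 1; 0, 0] + a 1 0 • !![0, 0; 1, 0] +
      a 1 1 • !![0, 0; 0, 1] := by
    ext i j; fin_cases i <;> fin_cases j <;> simp
  rw [ea]
  simp only [map_add, map_smul, Matrix.trace_add, Matrix.trace_smul, h01, h10, smul_eq_mul,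
    Matrix.trace_fin_two_of]
  linear_combination (a 0 0 / 2 + a 1 1 / 2) * h1 + (a 0 0 / 2 - a 1 1 / 2) * h11

/-- A trace-two projection in `M_4(ℂ)` is `V * Vᴴ` for an isometry `V : ℂ² → ℂ⁴`. -/
theorem exists_isometry_of_projection {e : Matrix (Fin 4) (Fin 4) ℂ} (he : e.IsHermitian)
    (hee : e * e = e) (htr : e.trace = 2) : ∃ V : Matrix (Fin 4) (Fin 2) ℂ,
      V.conjTranspose * V = 1 ∧ V * V.conjTranspose = e := by
  classical
  let U : Matrix (Fin 4) (Fin 4) ℂ := he.eigenvectorUnitary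
  have hU : U.conjTranspose * U = 1 := Unitary.coe_star_mul_self he.eigenvectorUnitary
  have hU' : U * U.conjTranspose = 1 := Unitary.coe_mul_star_self he.eigenvectorUnitary
  have hs : e = U * Matrix.diagonal (fun i => (he.eigenvalues i : ℂ)) * U.conjTranspose := by
    have := he.spectral_theorem
    rw [Unitary.conjStarAlgAut_apply] at this
    exact this
  have h01 : ∀ i, he.eigenvalues i = 0 ∨ he.eigenvalues i = 1 := by
    intro i
    have h1 : Matrix.diagonal (fun i => (he.eigenvalues i : ℂ)) = U.conjTranspose * e * U := by
      conv_rhs => rw [hs]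
      calc _ = 1 * Matrix.diagonal (fun i => (he.eigenvalues i : ℂ)) * 1 := by simp
        _ = _ := by rw [← hU]; simp only [mul_assoc]
    have h2 : Matrix.diagonal (fun i => (he.eigenvalues i : ℂ)) *
        Matrix.diagonal (fun i => (he.eigenvalues i : ℂ)) =
        Matrix.diagonal (fun i => (he.eigenvalues i : ℂ)) := by
      rw [h1]
      calc _ = U.conjTranspose * e * (U * U.conjTranspose) * e * U := by simp only [mul_assoc]
        _ = U.conjTranspose * (e * e) * U := by rw [hU', mul_one]; simp only [mul_assoc]
        _ = _ := by rw [hee]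
    have h3 := congrFun (congrFun h2 i) i
    rw [Matrix.diagonal_mul_diagonal, Matrix.diagonal_apply_eq, Matrix.diagonal_apply_eq] at h3
    have h4 : he.eigenvalues i * he.eigenvalues i = he.eigenvalues i := by exact_mod_cast h3
    rcases eq_or_ne (he.eigenvalues i) 0 with h | h
    · exact Or.inl h
    · exact Or.inr (mul_left_cancel₀ h (by rw [h4, mul_one]))
  have hcard : Fintype.card {i // he.eigenvalues i = 1} = 2 := by
    have h1 := he.trace_eq_sum_eigenvalues
    rw [htr] at h1
    have h2 : ∑ i, he.eigenvalues i = 2 := by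
      have : ((∑ i, he.eigenvalues i : ℝ) : ℂ) = 2 := by push_cast; exact h1.symm
      exact_mod_cast this
    have h3 : ∀ i, he.eigenvalues i = if he.eigenvalues i = 1 then 1 else 0 := fun i => by
      rcases h01 i with h | h <;> simp [h]
    rw [Finset.sum_congr rfl fun i _ => h3 i, Finset.sum_boole] at h2
    rw [Fintype.card_subtype]
    exact_mod_cast h2
  obtain ⟨f⟩ : Nonempty (Fin 2 ≃ {i // he.eigenvalues i = 1}) :=
    ⟨(Fintype.equivFinOfCardEq hcard).symm⟩
  refine ⟨U.submatrix id fun k => (f k).1, ?_, ?_⟩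
  · ext k l
    have := congrFun (congrFun hU (f k).1) (f l).1
    rw [Matrix.mul_apply] at this ⊢
    simpa [Matrix.one_apply, Subtype.val_inj] using this
  · conv_rhs => rw [hs]
    ext i j
    rw [Matrix.mul_apply, Matrix.mul_apply]
    simp only [Matrix.mul_diagonal, Matrix.submatrix_apply, id, Matrix.conjTranspose_apply]
    rw [f.sum_comp (fun k => U i k.1 * star (U j k.1)),
      ← Finset.sum_subtype (Finset.univ.filter fun k => he.eigenvalues k = 1) (by simp)
        (fun k => U i k * star (U j k)), Finset.sum_filter]
    refine Finset.sum_congr rfl fun k _ => ?_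
    rcases h01 k with h | h <;> simp [h]

/-- Compression of `Y` by a pair of isometries `W`, giving a `2 × 2` array of `2 × 2` blocks. -/
def block (W : Fin 2 → Matrix (Fin 4) (Fin 2) ℂ) (Y : Matrix (Fin 4) (Fin 4) ℂ) (i j : Fin 2) :
    Matrix (Fin 2) (Fin 2) ℂ :=
  (W i).conjTranspose * Y * W j

theorem block_add (W : Fin 2 → Matrix (Fin 4) (Fin 2) ℂ) (Y Z : Matrix (Fin 4) (Fin 4) ℂ)
    (i j : Fin 2) : block W (Y + Z) i j = block W Y i j + block W Z i j := by
  simp [block, Matrix.mul_add, Matrix.add_mul]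

theorem block_conjTranspose (W : Fin 2 → Matrix (Fin 4) (Fin 2) ℂ)
    (Y : Matrix (Fin 4) (Fin 4) ℂ) (i j : Fin 2) :
    block W Y.conjTranspose i j = (block W Y j i).conjTranspose := by
  simp [block, Matrix.mul_assoc]

/-- Coordinates of `M_4(ℂ)` in which `φ` is `a ↦ a ⊗ 1`. -/
theorem exists_block_frame (φ : Matrix (Fin 2) (Fin 2) ℂ →⋆ₐ[ℂ] Matrix (Fin 4) (Fin 4) ℂ) :
    ∃ W : Fin 2 → Matrix (Fin 4) (Fin 2) ℂ,
      (∀ Y Z i j, block W (Y * Z) i j = ∑ k, block W Y i k * block W Z k j) ∧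
      (∀ a i j, block W (φ a) i j = a i j • (1 : Matrix (Fin 2) (Fin 2) ℂ)) ∧
      (∀ Y Z, (∀ i j, block W Y i j = block W Z i j) → Y = Z) ∧
      ∀ Y a, (φ a * Y).trace = ∑ i, ∑ j, a i j * (block W Y j i).trace := by
  have hE : ∀ i j k l : Fin 2, φ (Matrix.single i j 1) * φ (Matrix.single k l 1) =
      if j = k then φ (Matrix.single i l 1) else 0 := by
    intro i j k l
    rw [← map_mul]
    split_ifs with h
    · subst h; simp
    · rw [Matrix.single_mul_single_of_ne _ _ _ _ h, map_zero]
  have hS : ∀ i j : Fin 2, (φ (Matrix.single i j 1)).conjTranspose = φ (Matrix.single j i 1) := by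
    intro i j
    rw [← Matrix.star_eq_conjTranspose, ← map_star, Matrix.star_eq_conjTranspose,
      Matrix.conjTranspose_single, star_one]
  obtain ⟨V, hV, hV'⟩ := exists_isometry_of_projection (e := φ (Matrix.single 0 0 1)) (hS 0 0)
    (by simp [hE]) (by simp [trace_starAlgHom])
  -- The isometry `V` onto the range of the image of $E_{00}$ is carried to the other diagonal
  -- matrix unit by the image of $E_{10}$.
  let W : Fin 2 → Matrix (Fin 4) (Fin 2) ℂ := fun i => φ (Matrix.single i 0 1) * V
  have hVE : φ (Matrix.single 0 0 1) * V = V := by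
    rw [← hV', Matrix.mul_assoc, hV, Matrix.mul_one]
  have hWW : ∀ i j, (W i).conjTranspose * W j = if i = j then 1 else 0 := by
    intro i j
    simp only [W, Matrix.conjTranspose_mul, hS]
    rw [Matrix.mul_assoc, ← Matrix.mul_assoc (φ _) (φ _), hE]
    split_ifs with h
    · rw [hVE, hV]
    · simp
  have hWE : ∀ i j, W i * (W j).conjTranspose = φ (Matrix.single i j 1) := by
    intro i j
    simp only [W, Matrix.conjTranspose_mul, hS]
    rw [Matrix.mul_assoc, ← Matrix.mul_assoc V, hV', hE, if_pos rfl, hE, if_pos rfl]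
  have hW1 : ∑ i, W i * (W i).conjTranspose = 1 := by
    simp only [hWE]
    rw [← map_sum, ← map_one φ]
    congr 1
    ext i j; fin_cases i <;> fin_cases j <;> simp [Fin.sum_univ_two]
  have hφ : ∀ a, φ a = ∑ i, ∑ j, a i j • (W i * (W j).conjTranspose) := by
    intro a
    simp only [hWE]
    conv_lhs => rw [Matrix.matrix_eq_sum_single a]
    simp only [map_sum, ← map_smul, Matrix.smul_single, smul_eq_mul, mul_one]
  clear_value W
  refine ⟨W, fun Y Z i j => ?_, fun a i j => ?_, fun Y Z h => ?_, fun Y a => ?_⟩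
  · calc block W (Y * Z) i j = (W i).conjTranspose * Y * (1 : Matrix (Fin 4) (Fin 4) ℂ) * Z * W j := by
          simp only [block, Matrix.mul_one, Matrix.mul_assoc]
      _ = _ := by
          rw [← hW1]
          simp only [block, Matrix.mul_sum, Matrix.sum_mul, Matrix.mul_assoc]
  · rw [hφ]
    simp only [block, Matrix.mul_sum, Matrix.sum_mul, Matrix.mul_smul, Matrix.smul_mul]
    have : ∀ k l, (W i).conjTranspose * (W k * (W l).conjTranspose) * W j =
        if i = k then (if l = j then 1 else 0) else 0 := by
      intro k l
      rw [← Matrix.mul_assoc, hWW, Matrix.mul_assoc, hWW]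
      split_ifs <;> simp
    simp [this]
  · have e : ∀ Y : Matrix (Fin 4) (Fin 4) ℂ,
        Y = ∑ i, ∑ j, W i * block W Y i j * (W j).conjTranspose := by
      intro Y
      calc Y = 1 * Y * 1 := by simp
        _ = _ := by
          rw [← hW1]
          simp only [block, Matrix.mul_sum, Matrix.sum_mul, Matrix.mul_assoc]
          rw [Finset.sum_comm]
    rw [e Y, e Z]
    simp only [h]
  · rw [hφ]
    simp only [Finset.sum_mul, Matrix.trace_sum, Matrix.smul_mul, Matrix.trace_smul, smul_eq_mul]
    refine Finset.sum_congr rfl fun i _ => Finset.sum_congr rfl fun j _ => ?_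
    rw [Matrix.mul_assoc, Matrix.trace_mul_comm, block]

/-! ### The involution commuting with a complementary F-subalgebra -/

/-- Anticommutators of traceless 2×2 matrices are scalar and commutators are traceless, so `h'`
splits into two equations. The traceless one equates the commutators $[t_a, t_c']$ and $[t_c,
t_a']$; the scalar one together with `h` equates the traces, hence the anticommutators. -/
theorem mul_eq_mul_of_traceless {b b' ta tc ta' tc' td td' : Matrix (Fin 2) (Fin 2) ℂ}
    (hb : b.trace = 0) (hb' : b'.trace = 0) (hta : ta.trace = 0) (htc : tc.trace = 0)
    (hta' : ta'.trace = 0) (htc' : tc'.trace = 0) (htd : td.trace = 0) (htd' : td'.trace = 0)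
    (h : (b * td' + td * b' + Complex.I • (ta * tc' - tc * ta')).trace = 0)
    (h' : (b * td' + td * b' + Complex.I • (ta * tc' - tc * ta')) +
      (b' * td + td' * b + Complex.I • (ta' * tc - tc' * ta)) = 0) : ta * tc' = tc * ta' := by
  have eta : ∀ m : Matrix (Fin 2) (Fin 2) ℂ, m.trace = 0 →
      m = !![m 0 0, m 0 1; m 1 0, - m 0 0] := by
    intro m hm
    rw [Matrix.trace_fin_two] at hm
    ext i j; fin_cases i <;> fin_cases j <;> simp
    linear_combination hm
  rw [eta b hb, eta b' hb', eta ta hta, eta tc htc, eta ta' hta', eta tc' htc', eta td htd,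
    eta td' htd'] at h h'
  rw [eta ta hta, eta tc htc, eta ta' hta', eta tc' htc']
  have h00 := congrFun (congrFun h' 0) 0
  have h01 := congrFun (congrFun h' 0) 1
  have h10 := congrFun (congrFun h' 1) 0
  have h11 := congrFun (congrFun h' 1) 1
  simp only [Matrix.mul_fin_two, Matrix.add_apply, Matrix.smul_apply, Matrix.sub_apply,
    Matrix.of_apply, Matrix.cons_val', Matrix.cons_val_zero, Matrix.cons_val_one,
    Matrix.cons_val_fin_one, Matrix.trace_fin_two, smul_eq_mul, Matrix.zero_apply] at h h00 h01 h10 h11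
  have hI := Complex.I_mul_I
  ext i j
  fin_cases i <;> fin_cases j <;> simp
  · linear_combination -Complex.I / 2 * h + Complex.I / 2 * h11 +
      (ta 0 0 * tc' 0 0 + ta 0 1 * tc' 1 0 - tc 0 0 * ta' 0 0 - tc 0 1 * ta' 1 0) * hI
  · linear_combination -Complex.I / 2 * h01 +
      (ta 0 0 * tc' 0 1 - ta 0 1 * tc' 0 0 - tc 0 0 * ta' 0 1 + tc 0 1 * ta' 0 0) * hI
  · linear_combination -Complex.I / 2 * h10 +
      (ta 1 0 * tc' 0 0 - ta 0 0 * tc' 1 0 - tc 1 0 * ta' 0 0 + tc 0 0 * ta' 1 0) * hI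
  · linear_combination -Complex.I / 2 * h + Complex.I / 2 * h00 +
      (ta 1 0 * tc' 0 1 + ta 0 0 * tc' 0 0 - tc 1 0 * ta' 0 1 - tc 0 0 * ta' 0 0) * hI

theorem pauli_trace (a : Fin 3) : (pauli a.succ).trace = 0 := by
  fin_cases a <;> simp [pauli, Matrix.trace_fin_two]

theorem pauli_conjTranspose (a : Fin 4) : (pauli a).conjTranspose = pauli a := by
  ext i j
  fin_cases a <;> fin_cases i <;> fin_cases j <;> simp [pauli]

theorem pauli_zero : pauli 0 = 1 := by
  ext i j
  fin_cases i <;> fin_cases j <;> simp [pauli]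

theorem mul_add_mul_of_trace_eq_zero {m n : Matrix (Fin 2) (Fin 2) ℂ} (hm : m.trace = 0)
    (hn : n.trace = 0) : m * n + n * m = (m * n).trace • (1 : Matrix (Fin 2) (Fin 2) ℂ) := by
  rw [Matrix.trace_fin_two] at hm hn
  ext i j
  fin_cases i <;> fin_cases j <;>
    simp [Matrix.mul_apply, Matrix.trace_fin_two, Fin.sum_univ_two]
  · linear_combination n 0 0 * hm - m 1 1 * hn
  · linear_combination n 0 1 * hm + m 0 1 * hn
  · linear_combination n 1 0 * hm + m 1 0 * hn
  · linear_combination n 1 1 * hm - m 0 0 * hn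

/-- The coefficients of a `2 × 2` array of blocks with respect to the Pauli matrices. -/
noncomputable def blockCoeff (Y : Fin 2 → Fin 2 → Matrix (Fin 2) (Fin 2) ℂ) :
    Fin 4 → Matrix (Fin 2) (Fin 2) ℂ :=
  ![(1 / 2 : ℂ) • (Y 0 0 + Y 1 1), (1 / 2 : ℂ) • (Y 0 1 + Y 1 0),
    (Complex.I / 2) • (Y 0 1 - Y 1 0), (1 / 2 : ℂ) • (Y 0 0 - Y 1 1)]

theorem blockCoeff_spec (Y : Fin 2 → Fin 2 → Matrix (Fin 2) (Fin 2) ℂ) (i j : Fin 2) :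
    Y i j = ∑ a, pauli a i j • blockCoeff Y a := by
  rw [Fin.sum_univ_four]
  ext u v
  have hI := Complex.I_mul_I
  fin_cases i <;> fin_cases j <;> simp [blockCoeff, pauli]
  · ring
  · linear_combination (1 / 2 * (Y 0 1 u v - Y 1 0 u v)) * hI
  · linear_combination (-1 / 2 * (Y 0 1 u v - Y 1 0 u v)) * hI
  · ring

/-- This is the $\sigma_d$-component of a product, from $\sigma_a\sigma_c = i\sigma_d =
-\sigma_c\sigma_a$ for cyclic triples. -/
theorem blockCoeff_mul (Y Z : Fin 2 → Fin 2 → Matrix (Fin 2) (Fin 2) ℂ) (a c d : Fin 3)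
    (h : (a, c, d) ∈ [((0 : Fin 3), (1 : Fin 3), (2 : Fin 3)), (1, 2, 0), (2, 0, 1)]) :
    blockCoeff (fun i j => ∑ k, Y i k * Z k j) d.succ =
      blockCoeff Y 0 * blockCoeff Z d.succ + blockCoeff Y d.succ * blockCoeff Z 0 +
        Complex.I • (blockCoeff Y a.succ * blockCoeff Z c.succ -
          blockCoeff Y c.succ * blockCoeff Z a.succ) := by
  simp only [List.mem_cons, Prod.mk.injEq, List.not_mem_nil, or_false] at h
  rcases h with ⟨rfl, rfl, rfl⟩ | ⟨rfl, rfl, rfl⟩ | ⟨rfl, rfl, rfl⟩ <;>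
  simp only [blockCoeff, Fin.sum_univ_two, Fin.succ_zero_eq_one, Fin.succ_one_eq_two,
    Matrix.cons_val, show Fin.succ (2 : Fin 3) = 3 from rfl, smul_mul_smul_comm] <;>
  simp only [smul_sub, smul_smul] <;>
  ring_nf <;> (try simp only [Complex.I_sq]) <;>
  simp only [mul_add, add_mul, mul_sub, sub_mul] <;> module

/-- The Pauli coefficients of a traceless element of a complementary
F-subalgebra satisfy the relations of a rank-one matrix. -/
theorem blockCoeff_mul_blockCoeff
    {ψ : Matrix (Fin 2) (Fin 2) ℂ →⋆ₐ[ℂ] Matrix (Fin 4) (Fin 4) ℂ}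
    {W : Fin 2 → Matrix (Fin 4) (Fin 2) ℂ}
    (hmul : ∀ Y Z i j, block W (Y * Z) i j = ∑ k, block W Y i k * block W Z k j)
    (hone : ∀ i j, block W 1 i j = if i = j then 1 else 0)
    (htr : ∀ m i j, (block W (ψ m) i j).trace = if i = j then m.trace else 0)
    {m n : Matrix (Fin 2) (Fin 2) ℂ} (hm : m.trace = 0) (hn : n.trace = 0) (a c : Fin 3) :
    blockCoeff (block W (ψ m)) a.succ * blockCoeff (block W (ψ n)) c.succ =
      blockCoeff (block W (ψ m)) c.succ * blockCoeff (block W (ψ n)) a.succ := by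
  have h0 : ∀ m, m.trace = 0 → ∀ a, (blockCoeff (block W (ψ m)) a).trace = 0 := by
    intro m hm a
    fin_cases a <;> simp [blockCoeff, htr, hm]
  have h1 : ∀ m (a : Fin 3), (blockCoeff (block W (ψ m)) a.succ).trace = 0 := by
    intro m a
    fin_cases a <;> simp [blockCoeff, htr]
  have h2 : ∀ m n, (fun i j => ∑ k, block W (ψ m) i k * block W (ψ n) k j) =
      block W (ψ (m * n)) := by
    intro m n
    funext i j
    rw [map_mul, hmul]
  have key : ∀ a c d : Fin 3,
      (a, c, d) ∈ [((0 : Fin 3), (1 : Fin 3), (2 : Fin 3)), (1, 2, 0), (2, 0, 1)] →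
      blockCoeff (block W (ψ m)) a.succ * blockCoeff (block W (ψ n)) c.succ =
      blockCoeff (block W (ψ m)) c.succ * blockCoeff (block W (ψ n)) a.succ := by
    intro a c d h
    have e := blockCoeff_mul (block W (ψ m)) (block W (ψ n)) a c d h
    have e' := blockCoeff_mul (block W (ψ n)) (block W (ψ m)) a c d h
    rw [h2] at e e'
    refine mul_eq_mul_of_traceless (h0 m hm 0) (h0 n hn 0) (h1 m a) (h1 m c) (h1 n a) (h1 n c)
      (h1 m d) (h1 n d) (by rw [← e, h1]) ?_
    rw [← e, ← e']
    -- The symmetrized product is scalar, so its $\sigma_d$-coefficient vanishes; this is the second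
    -- hypothesis of `mul_eq_mul_of_traceless`.
    have e3 : ψ (m * n) + ψ (n * m) = (m * n).trace • 1 := by
      rw [← map_add, mul_add_mul_of_trace_eq_zero hm hn, map_smul, map_one]
    have e4 : ∀ i j, block W (ψ (m * n)) i j + block W (ψ (n * m)) i j =
        if i = j then (m * n).trace • 1 else 0 := by
      intro i j
      rw [← block_add, e3]
      have := hone i j
      simp only [block, Matrix.mul_smul, Matrix.smul_mul] at this ⊢
      rw [this]
      split_ifs <;> simp
    have e00 := e4 0 0
    have e01 := e4 0 1
    have e10 := e4 1 0
    have e11 := e4 1 1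
    simp only [if_true, zero_ne_one, one_ne_zero, if_false] at e00 e01 e10 e11
    have f0 := eq_sub_of_add_eq e00
    have f1 := eq_sub_of_add_eq e01
    have f2 := eq_sub_of_add_eq e10
    have f3 := eq_sub_of_add_eq e11
    fin_cases d <;> simp only [blockCoeff, Matrix.cons_val, Fin.succ_zero_eq_one,
      Fin.succ_one_eq_two, Fin.reduceFinMk, Fin.reduceSucc, Fin.zero_eta, Fin.mk_one,
      f0, f1, f2, f3] <;> module
  fin_cases a <;> fin_cases c
  · rfl
  · exact key 0 1 2 (by simp)
  · exact (key 2 0 1 (by simp)).symm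
  · exact (key 0 1 2 (by simp)).symm
  · rfl
  · exact key 1 2 0 (by simp)
  · exact key 2 0 1 (by simp)
  · exact (key 1 2 0 (by simp)).symm
  · rfl

theorem blockCoeff_isHermitian {Y : Fin 2 → Fin 2 → Matrix (Fin 2) (Fin 2) ℂ}
    (hY : ∀ i j, Y i j = (Y j i).conjTranspose) (a : Fin 4) :
    (blockCoeff Y a).conjTranspose = blockCoeff Y a := by
  fin_cases a <;> simp only [blockCoeff, Matrix.cons_val, Fin.reduceFinMk, Fin.zero_eta, Fin.mk_one,
    Matrix.conjTranspose_smul, Matrix.conjTranspose_add, Matrix.conjTranspose_sub, ← hY] <;>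
    simp <;> module

open scoped ComplexOrder in
/-- Hermitian traceless `2 × 2` matrices satisfying the rank-one relations have proportional
coefficients. -/
theorem exists_common_direction {ι : Type*} (t : Fin 3 → ι → Matrix (Fin 2) (Fin 2) ℂ)
    (htr : ∀ a j, (t a j).trace = 0) (hh : ∀ a j, (t a j).conjTranspose = t a j)
    (h : ∀ a c i j, t a i * t c j = t c i * t a j) :
    ∃ (l : Fin 3 → ℝ) (w : ι → Matrix (Fin 2) (Fin 2) ℂ), ∑ a, l a ^ 2 = 1 ∧
      ∀ a j, t a j = (l a : ℂ) • w j := by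
  suffices H : ∃ (l : Fin 3 → ℝ) (w : ι → Matrix (Fin 2) (Fin 2) ℂ) (b : Fin 3), l b ≠ 0 ∧
      ∀ a j, t a j = (l a : ℂ) • w j by
    obtain ⟨l, w, b, hb, hw⟩ := H
    have hpos : 0 < ∑ a, l a ^ 2 :=
      Finset.sum_pos' (fun a _ => sq_nonneg _) ⟨b, Finset.mem_univ _, by positivity⟩
    have hr : √(∑ a, l a ^ 2) ≠ 0 := (Real.sqrt_pos.2 hpos).ne'
    refine ⟨fun a => l a / √(∑ a, l a ^ 2), fun j => ((√(∑ a, l a ^ 2) : ℝ) : ℂ) • w j, ?_, ?_⟩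
    · simp only [div_pow, ← Finset.sum_div, Real.sq_sqrt hpos.le, div_self hpos.ne']
    · intro a j
      rw [hw, smul_smul, ← Complex.ofReal_mul, div_mul_cancel₀ _ hr]
  by_cases h0 : ∀ a j, t a j = 0
  · exact ⟨fun _ => 1, fun _ => 0, 0, one_ne_zero, fun a j => by simp [h0]⟩
  push Not at h0
  obtain ⟨b, i, hbi⟩ := h0
  have hreal : ∀ a, (((t b i * t a i).trace.re : ℝ) : ℂ) = (t b i * t a i).trace := by
    intro a
    rw [← Complex.conj_eq_iff_re, ← RCLike.star_def, ← Matrix.trace_conjTranspose,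
      Matrix.conjTranspose_mul, hh, hh, Matrix.trace_mul_comm]
  -- The relation with equal second indices makes `t b i` and `t a i` commute, so their product is
  -- half their scalar anticommutator.
  have hsq : ∀ a, t b i * t a i = ((t b i * t a i).trace / 2) • 1 := by
    intro a
    have h1 := mul_add_mul_of_trace_eq_zero (htr b i) (htr a i)
    rw [← h b a i i, ← two_smul ℂ] at h1
    rw [div_eq_inv_mul, mul_smul, ← h1, smul_smul]
    norm_num
  have hne : (t b i * t b i).trace ≠ 0 := by
    intro h0
    have : ((t b i).conjTranspose * t b i).trace = 0 := by rw [hh, h0]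
    exact hbi (Matrix.trace_conjTranspose_mul_self_eq_zero_iff.1 this)
  -- Multiplying `t a j` by the nonzero scalar matrix `t b i * t b i` and using the relation gives
  -- the scalar `t b i * t a i` times `t b j`; the ratio of these scalars is the coefficient, real
  -- by hermiticity.
  refine ⟨fun a => (t b i * t a i).trace.re / (t b i * t b i).trace.re, fun j => t b j, b, ?_, ?_⟩
  · change _ / _ ≠ 0
    rw [div_self]
    · exact one_ne_zero
    · intro h0
      rw [← hreal, h0] at hne
      simp at hne
  · intro a j
    have h1 : t b i * t b i * t a j = t b i * t a i * t b j := by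
      rw [mul_assoc, h b a i j, mul_assoc]
    rw [hsq, hsq a, Matrix.smul_mul, Matrix.smul_mul, one_mul, one_mul] at h1
    push_cast
    rw [hreal, hreal, div_eq_mul_inv, mul_comm, mul_smul, eq_inv_smul_iff₀ hne]
    have := congrArg (fun z => (2 : ℂ) • z) h1
    simpa [smul_smul, mul_div_cancel₀] using this

/-- An F-subalgebra contains a traceless Hermitian unitary commuting with any given complementary
F-subalgebra. -/
theorem exists_involution_commuting
    (φ ψ : Matrix (Fin 2) (Fin 2) ℂ →⋆ₐ[ℂ] Matrix (Fin 4) (Fin 4) ℂ)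
    (hc : ∀ m n, normTrace (φ m * ψ n) = normTrace (φ m) * normTrace (ψ n)) :
    ∃ m : Matrix (Fin 2) (Fin 2) ℂ, m.conjTranspose = m ∧ m.trace = 0 ∧ m * m = 1 ∧
      ∀ a : Fin 3, φ m * ψ (pauli a.succ) = ψ (pauli a.succ) * φ m := by
  obtain ⟨W, hmul, hφ, hinj, htrace⟩ := exists_block_frame φ
  have hone : ∀ i j, block W 1 i j = if i = j then 1 else 0 := by
    intro i j
    rw [← map_one φ, hφ, Matrix.one_apply]
    split_ifs <;> simp
  -- Complementarity tested against matrix units determines the trace of every block.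
  have htr : ∀ m i j, (block W (ψ m) i j).trace = if i = j then m.trace else 0 := by
    intro m i j
    have := hc (Matrix.single j i 1) m
    rw [normTrace, htrace, normTrace, normTrace, trace_starAlgHom, trace_starAlgHom] at this
    have e : ∑ p, ∑ q, Matrix.single j i (1 : ℂ) p q * (block W (ψ m) q p).trace =
        (block W (ψ m) i j).trace := by
      simp [Matrix.single_apply, ite_and]
    rw [e] at this
    have e2 : (Matrix.single j i (1 : ℂ)).trace = if i = j then 1 else 0 := by
      split_ifs with hij
      · subst hij; simp
      · exact Matrix.trace_single_eq_of_ne _ _ _ (Ne.symm hij)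
    rw [e2] at this
    split_ifs at this ⊢ with hij
    · norm_num at this
      linear_combination 4 * this
    · norm_num at this
      exact this
  obtain ⟨l, w, hl, hw⟩ := exists_common_direction
    (fun a j : Fin 3 => blockCoeff (block W (ψ (pauli j.succ))) a.succ)
    (fun a j => by fin_cases a <;> simp [blockCoeff, htr])
    (fun a j => blockCoeff_isHermitian (fun p q => by
      rw [← block_conjTranspose, ← Matrix.star_eq_conjTranspose, ← map_star,
        Matrix.star_eq_conjTranspose, pauli_conjTranspose]) _)
    (fun a c i j => blockCoeff_mul_blockCoeff hmul hone htr (pauli_trace i) (pauli_trace j) a c)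
  -- In block coordinates $\psi(\sigma_j) = 1\otimes b_j + m\otimes w_j$, which commutes with $m
  -- \otimes 1$; the unit vector `l` makes `m` an involution.
  let m : Matrix (Fin 2) (Fin 2) ℂ := ∑ a : Fin 3, (l a : ℂ) • pauli a.succ
  have hmm : m * m = 1 := by
    have hl' : (l 0 : ℂ) ^ 2 + (l 1 : ℂ) ^ 2 + (l 2 : ℂ) ^ 2 = 1 := by
      rw [Fin.sum_univ_three] at hl
      exact_mod_cast hl
    have hI := Complex.I_mul_I
    ext i j
    fin_cases i <;> fin_cases j <;>
      simp [m, Fin.sum_univ_three, pauli, Matrix.mul_apply, Fin.sum_univ_two]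
    · linear_combination hl' - (l 1 : ℂ) ^ 2 * hI
    · ring
    · ring
    · linear_combination hl' - (l 1 : ℂ) ^ 2 * hI
  refine ⟨m, ?_, ?_, hmm, fun a => hinj _ _ fun i j => ?_⟩
  · simp [m, Matrix.conjTranspose_sum, Matrix.conjTranspose_smul, pauli_conjTranspose]
  · simp [m, Matrix.trace_sum, pauli_trace]
  · have e : ∀ i j, block W (ψ (pauli a.succ)) i j =
        (1 : Matrix (Fin 2) (Fin 2) ℂ) i j • blockCoeff (block W (ψ (pauli a.succ))) 0 +
          m i j • w a := by
      intro i j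
      conv_lhs => rw [blockCoeff_spec (block W (ψ (pauli a.succ))) i j, Fin.sum_univ_succ, pauli_zero]
      simp only [hw, m, Matrix.sum_apply, Finset.sum_smul, Matrix.smul_apply, smul_smul,
        smul_eq_mul, mul_comm]
    rw [hmul, hmul]
    simp only [hφ, Matrix.smul_mul, Matrix.mul_smul, one_mul, mul_one]
    simp only [e, Fin.sum_univ_two]
    revert i j
    simp only [Fin.forall_fin_two]
    refine ⟨⟨?_, ?_⟩, ?_, ?_⟩ <;> simp <;> module

/-! ### Twirls -/

/-- The map `X ↦ X + ∑ e i * X * e i`. If `1, e 0, e 1, e 2` are the Pauli matrices of an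
F-subalgebra, this is four times the trace-preserving projection onto its commutant. -/
def twirl (e : Fin 3 → Matrix (Fin 4) (Fin 4) ℂ) (X : Matrix (Fin 4) (Fin 4) ℂ) :
    Matrix (Fin 4) (Fin 4) ℂ :=
  X + ∑ i, e i * X * e i

/-- The twirl is a bimodule map over the commutant of the triple; this is how the commuting
involutions are exploited. -/
theorem twirl_mul_left {e : Fin 3 → Matrix (Fin 4) (Fin 4) ℂ} {p : Matrix (Fin 4) (Fin 4) ℂ}
    (hp : ∀ i, p * e i = e i * p) (X : Matrix (Fin 4) (Fin 4) ℂ) :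
    twirl e (p * X) = p * twirl e X := by
  simp only [twirl, mul_add, Finset.mul_sum, ← mul_assoc, hp]

theorem twirl_mul_right {e : Fin 3 → Matrix (Fin 4) (Fin 4) ℂ} {p : Matrix (Fin 4) (Fin 4) ℂ}
    (hp : ∀ i, p * e i = e i * p) (X : Matrix (Fin 4) (Fin 4) ℂ) :
    twirl e (X * p) = twirl e X * p := by
  simp only [twirl, add_mul, Finset.sum_mul, mul_assoc, hp]

theorem twirl_sub (e : Fin 3 → Matrix (Fin 4) (Fin 4) ℂ) (X Y : Matrix (Fin 4) (Fin 4) ℂ) :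
    twirl e (X - Y) = twirl e X - twirl e Y := by
  simp only [twirl, mul_sub, sub_mul, Finset.sum_sub_distrib]
  abel

theorem twirl_of_commute {e : Fin 3 → Matrix (Fin 4) (Fin 4) ℂ} {p : Matrix (Fin 4) (Fin 4) ℂ}
    (he : ∀ i, e i * e i = 1) (hp : ∀ i, p * e i = e i * p) : twirl e p = (4 : ℂ) • p := by
  simp only [twirl, ← hp, mul_assoc, he, Fin.sum_univ_three, mul_one]
  module

theorem trace_twirl {e : Fin 3 → Matrix (Fin 4) (Fin 4) ℂ} (he : ∀ i, e i * e i = 1)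
    (X : Matrix (Fin 4) (Fin 4) ℂ) : (twirl e X).trace = 4 * X.trace := by
  have : ∀ i, (e i * X * e i).trace = X.trace := fun i => by
    rw [Matrix.trace_mul_comm, ← mul_assoc, he, one_mul]
  simp only [twirl, Matrix.trace_add, Fin.sum_univ_three, this]
  ring

/-- The triple `φ σ₁, φ σ₂, φ σ₃`. -/
noncomputable def pauliTriple (φ : Matrix (Fin 2) (Fin 2) ℂ →⋆ₐ[ℂ] Matrix (Fin 4) (Fin 4) ℂ)
    (i : Fin 3) : Matrix (Fin 4) (Fin 4) ℂ :=
  φ (pauli i.succ)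

section

variable (φ : Matrix (Fin 2) (Fin 2) ℂ →⋆ₐ[ℂ] Matrix (Fin 4) (Fin 4) ℂ)

theorem pauliTriple_mul_self (i : Fin 3) : pauliTriple φ i * pauliTriple φ i = 1 := by
  rw [pauliTriple, ← map_mul, ← map_one φ]
  congr 1
  fin_cases i <;> ext a b <;> fin_cases a <;> fin_cases b <;>
    simp [pauli, Matrix.mul_apply, Fin.sum_univ_two]

theorem trace_pauliTriple (i : Fin 3) : (pauliTriple φ i).trace = 0 := by
  rw [pauliTriple, trace_starAlgHom, pauli_trace, mul_zero]

theorem trace_pauliTriple_mul (i j : Fin 3) :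
    (pauliTriple φ i * pauliTriple φ j).trace = if i = j then 4 else 0 := by
  rw [pauliTriple, pauliTriple, ← map_mul, trace_starAlgHom]
  fin_cases i <;> fin_cases j <;>
    simp [pauli, Matrix.trace_fin_two] <;> norm_num

theorem conjTranspose_pauliTriple (i : Fin 3) :
    (pauliTriple φ i).conjTranspose = pauliTriple φ i := by
  rw [pauliTriple, ← Matrix.star_eq_conjTranspose, ← map_star, Matrix.star_eq_conjTranspose,
    pauli_conjTranspose]

theorem twirl_pauliTriple_self {m : Matrix (Fin 2) (Fin 2) ℂ} (hm : m.trace = 0) :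
    twirl (pauliTriple φ) (φ m) = 0 := by
  simp only [twirl, pauliTriple, ← map_mul, ← map_sum, ← map_add]
  rw [← map_zero φ]
  congr 1
  rw [Matrix.trace_fin_two] at hm
  have hI := Complex.I_mul_I
  rw [Matrix.eta_fin_two m]
  ext i j
  fin_cases i <;> fin_cases j <;> simp [pauli, Fin.sum_univ_three]
  · linear_combination 2 * hm - m 1 1 * hI
  · linear_combination m 1 0 * hI
  · linear_combination m 0 1 * hI
  · linear_combination 2 * hm - m 0 0 * hI

/-- Conjugation by one member of the triple permutes the four terms of the twirl: multiplication
permutes the Pauli matrices up to phases, which cancel between the two sides. -/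
theorem commute_twirl_pauliTriple (X : Matrix (Fin 4) (Fin 4) ℂ) (i : Fin 3) :
    twirl (pauliTriple φ) X * pauliTriple φ i = pauliTriple φ i * twirl (pauliTriple φ) X := by
  have key : ∀ a b c : Fin 3,
      (a, b, c) ∈ [((0 : Fin 3), (1 : Fin 3), (2 : Fin 3)), (1, 2, 0), (2, 0, 1)] →
      pauliTriple φ a * pauliTriple φ b = Complex.I • pauliTriple φ c ∧
      pauliTriple φ b * pauliTriple φ a = -(Complex.I • pauliTriple φ c) := by
    intro a b c h
    simp only [pauliTriple, ← map_mul, ← map_smul, ← map_neg]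
    simp only [List.mem_cons, Prod.mk.injEq, List.not_mem_nil, or_false] at h
    rcases h with ⟨rfl, rfl, rfl⟩ | ⟨rfl, rfl, rfl⟩ | ⟨rfl, rfl, rfl⟩ <;> constructor <;>
      congr 1 <;> ext i j <;> fin_cases i <;> fin_cases j <;>
      simp [pauli, Matrix.mul_apply, Fin.sum_univ_two]
  obtain ⟨h01, h10⟩ := key 0 1 2 (by simp)
  obtain ⟨h12, h21⟩ := key 1 2 0 (by simp)
  obtain ⟨h20, h02⟩ := key 2 0 1 (by simp)
  have hs := pauliTriple_mul_self φ
  simp only [twirl, Fin.sum_univ_three, add_mul, mul_add]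
  fin_cases i <;>
  · simp only [Fin.zero_eta, Fin.mk_one, Fin.reduceFinMk]
    simp only [mul_assoc, hs, h01, h10, h12, h21, h20, h02, mul_one, mul_neg, mul_smul_comm]
    simp only [← mul_assoc, hs, h01, h10, h12, h21, h20, h02, one_mul, neg_mul, smul_mul_assoc]
    module

theorem conjTranspose_twirl_pauliTriple {X : Matrix (Fin 4) (Fin 4) ℂ}
    (hX : X.conjTranspose = X) :
    (twirl (pauliTriple φ) X).conjTranspose = twirl (pauliTriple φ) X := by
  simp only [twirl, Matrix.conjTranspose_add, Matrix.conjTranspose_sum, Matrix.conjTranspose_mul,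
    hX, conjTranspose_pauliTriple, mul_assoc]

/-- The right factor lies in the commutant, so it can be moved inside the other twirl, which
multiplies traces by four. -/
theorem trace_twirl_mul_twirl (X : Matrix (Fin 4) (Fin 4) ℂ) :
    (twirl (pauliTriple φ) X * twirl (pauliTriple φ) X).trace =
      4 * (X * twirl (pauliTriple φ) X).trace := by
  rw [← twirl_mul_right (commute_twirl_pauliTriple φ X), trace_twirl (pauliTriple_mul_self φ)]

end

/-! ### Counting the F-subalgebras -/

/-- Sixteen trace-orthogonal matrices, arranged as the identity and five triples. -/
theorem sum_twirl {e : Fin 5 → Fin 3 → Matrix (Fin 4) (Fin 4) ℂ} (htr : ∀ k i, (e k i).trace = 0)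
    (horth : ∀ k i j, (e k i * e k j).trace = if i = j then 4 else 0)
    (hcross : ∀ k l, k ≠ l → ∀ i j, (e k i * e l j).trace = 0)
    {X : Matrix (Fin 4) (Fin 4) ℂ} (hX : X.trace = 0) : ∑ k, twirl (e k) X = (4 : ℂ) • X := by
  have h := sum_mul_mul_of_trace_orthogonal (ι := Option (Fin 5 × Fin 3)) (by simp)
    (fun o => o.elim 1 fun p => e p.1 p.2) (by
      rintro (_ | ⟨k, i⟩) (_ | ⟨l, j⟩)
      · simp
      · simp [htr]
      · simp [htr]
      · by_cases hkl : k = l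
        · subst hkl
          simp [horth]
        · simp [hkl, hcross k l hkl]) X
  rw [Fintype.sum_option, hX, mul_zero, zero_smul, Fintype.sum_prod_type] at h
  simp only [Option.elim, one_mul, mul_one] at h
  simp only [twirl, Finset.sum_add_distrib, Finset.sum_const, Finset.card_univ, Fintype.card_fin]
  -- The five copies of `X` minus the one coming from the identity element of the basis leave the
  -- factor 4.
  rw [eq_neg_of_add_eq_zero_right h]
  module

theorem trace_mul_eq_zero_of_isComplementary
    {A B : StarSubalgebra ℂ (Matrix (Fin 4) (Fin 4) ℂ)} (h : IsComplementary A B)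
    {X Y : Matrix (Fin 4) (Fin 4) ℂ} (hX : X ∈ A) (hY : Y ∈ B) (hY' : Y.trace = 0) :
    (X * Y).trace = 0 := by
  have := h X hX Y hY
  simpa [normTrace, hY'] using this

/-- Data attached to a complementary decomposition: for each subalgebra a trace-orthogonal triple
spanning its traceless part, which consists of the Pauli matrices for an F-subalgebra. -/
theorem IsComplementaryDecomposition.exists_triples
    {A : Fin 5 → StarSubalgebra ℂ (Matrix (Fin 4) (Fin 4) ℂ)}
    (hA : IsComplementaryDecomposition A) :
    ∃ e : Fin 5 → Fin 3 → Matrix (Fin 4) (Fin 4) ℂ,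
      (∀ k, IsFSubalgebra (A k) → ∃ φ : Matrix (Fin 2) (Fin 2) ℂ →⋆ₐ[ℂ] Matrix (Fin 4) (Fin 4) ℂ,
        (∀ X, X ∈ A k ↔ ∃ a, φ a = X) ∧ e k = pauliTriple φ) ∧
      (∀ k, ¬ IsFSubalgebra (A k) → ∀ X, (∀ Y ∈ A k, (Y * X).trace = 0) → twirl (e k) X = 0) ∧
      ∀ X : Matrix (Fin 4) (Fin 4) ℂ, X.trace = 0 → ∑ k, twirl (e k) X = (4 : ℂ) • X := by
  have H : ∀ k, ∃ e : Fin 3 → Matrix (Fin 4) (Fin 4) ℂ, (∀ i, e i ∈ A k) ∧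
      (∀ i, (e i).trace = 0) ∧ (∀ i j, (e i * e j).trace = if i = j then 4 else 0) ∧
      (IsFSubalgebra (A k) → ∃ φ : Matrix (Fin 2) (Fin 2) ℂ →⋆ₐ[ℂ] Matrix (Fin 4) (Fin 4) ℂ,
        (∀ X, X ∈ A k ↔ ∃ a, φ a = X) ∧ e = pauliTriple φ) ∧
      (¬ IsFSubalgebra (A k) → ∀ X, (∀ Y ∈ A k, (Y * X).trace = 0) → twirl e X = 0) := by
    intro k
    by_cases hF : IsFSubalgebra (A k)
    · obtain ⟨φ, hφ⟩ := hF.exists_starAlgHom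
      exact ⟨pauliTriple φ, fun i => (hφ _).2 ⟨_, rfl⟩, trace_pauliTriple φ,
        trace_pauliTriple_mul φ, fun _ => ⟨φ, hφ, rfl⟩, fun h => absurd hF h⟩
    · obtain ⟨e, h1, h2, h3, h4⟩ := ((hA.1 k).resolve_left hF).exists_basis
      exact ⟨e, h1, h2, h3, fun h => absurd h hF, fun _ => h4⟩
  choose e h1 h2 h3 h4 h5 using H
  exact ⟨e, h4, h5, fun X hX => sum_twirl h2 h3 (fun k l hkl i j =>
    trace_mul_eq_zero_of_isComplementary (hA.2 hkl) (h1 k i) (h1 l j) (h2 l j)) hX⟩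

-- Up to the factor 4 this is the squared Hilbert–Schmidt norm of the Hermitian matrix `twirl
-- (pauliTriple φ) X`.
open scoped ComplexOrder in
theorem trace_mul_twirl_pauliTriple_nonneg
    (φ : Matrix (Fin 2) (Fin 2) ℂ →⋆ₐ[ℂ] Matrix (Fin 4) (Fin 4) ℂ)
    {X : Matrix (Fin 4) (Fin 4) ℂ} (hX : X.conjTranspose = X) :
    0 ≤ (X * twirl (pauliTriple φ) X).trace := by
  have h := (Matrix.posSemidef_conjTranspose_mul_self (twirl (pauliTriple φ) X)).trace_nonneg
  rw [conjTranspose_twirl_pauliTriple φ hX, trace_twirl_mul_twirl] at h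
  simpa [Complex.le_def, eq_comm] using h

open scoped ComplexOrder in
theorem twirl_pauliTriple_eq_zero
    (φ : Matrix (Fin 2) (Fin 2) ℂ →⋆ₐ[ℂ] Matrix (Fin 4) (Fin 4) ℂ)
    {X : Matrix (Fin 4) (Fin 4) ℂ} (hX : X.conjTranspose = X)
    (h : (X * twirl (pauliTriple φ) X).trace = 0) : twirl (pauliTriple φ) X = 0 := by
  rw [← Matrix.trace_conjTranspose_mul_self_eq_zero_iff, conjTranspose_twirl_pauliTriple φ hX,
    trace_twirl_mul_twirl, h, mul_zero]

/-- At most three traceless `2 × 2` matrices are orthonormal for the normalized trace form. -/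
theorem card_le_three_of_trace_orthogonal {ι : Type*} [Fintype ι] [DecidableEq ι]
    (m : ι → Matrix (Fin 2) (Fin 2) ℂ)
    (h0 : ∀ i, (m i).trace = 0) (h : ∀ i j, (m i * m j).trace = if i = j then 2 else 0) :
    Fintype.card ι ≤ 3 := by
  have hli : LinearIndependent ℂ (fun o : Option ι => o.elim 1 m) := by
    have key : ∀ o p : Option ι, ((o.elim 1 m : Matrix (Fin 2) (Fin 2) ℂ) * p.elim 1 m).trace =
        if o = p then 2 else 0 := by
      rintro (_ | i) (_ | j) <;> simp [h0, h]
    rw [Fintype.linearIndependent_iff]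
    intro g hg p
    have := congrArg (fun X => (X * p.elim 1 m).trace) hg
    simp only [Finset.sum_mul, Matrix.trace_sum, Matrix.smul_mul, Matrix.trace_smul, key] at this
    simpa using this
  have := hli.fintype_card_le_finrank
  simp [Module.finrank_matrix] at this
  omega

open scoped ComplexOrder in
/-- The number of F-subalgebras in a complementary decomposition is `0`, `2` or `4`. -/
theorem IsComplementaryDecomposition.ncard_mem
    {A : Fin 5 → StarSubalgebra ℂ (Matrix (Fin 4) (Fin 4) ℂ)}
    (hA : IsComplementaryDecomposition A) :
    {k : Fin 5 | IsFSubalgebra (A k)}.ncard ∈ ({0, 2, 4} : Set ℕ) := by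
  classical
  obtain ⟨e, hF, hM, hsum⟩ := hA.exists_triples
  have hsq : ∀ k, IsFSubalgebra (A k) → ∀ i, e k i * e k i = 1 := by
    intro k hk
    obtain ⟨φ, -, he⟩ := hF k hk
    rw [he]
    exact pauliTriple_mul_self φ
  let S : Finset (Fin 5) := Finset.univ.filter fun k => IsFSubalgebra (A k)
  have hS : {k : Fin 5 | IsFSubalgebra (A k)}.ncard = S.card := by
    rw [← Set.ncard_coe_finset]
    simp [S]
  have mem_S : ∀ k, k ∈ S ↔ IsFSubalgebra (A k) := by simp [S]
  -- the twirls of the other F-subalgebras resolve the identity on a given F-subalgebra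
  have main : ∀ j ∈ S, ∀ X ∈ A j, X.trace = 0 →
      ∑ k ∈ S.erase j, twirl (e k) X = (4 : ℂ) • X := by
    intro j hj X hX hX0
    rw [← hsum X hX0]
    -- The omitted terms vanish: the twirl of `j` kills its own traceless elements, and that of an
    -- M-subalgebra kills everything orthogonal to it.
    refine Finset.sum_subset (Finset.subset_univ _) fun k _ hk => ?_
    by_cases hkj : k = j
    · subst hkj
      obtain ⟨φ, hφ, he⟩ := hF k ((mem_S k).1 hj)
      obtain ⟨m, rfl⟩ := (hφ X).1 hX
      rw [he]
      refine twirl_pauliTriple_self φ ?_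
      rw [trace_starAlgHom] at hX0
      simpa using hX0
    · have hk' : ¬ IsFSubalgebra (A k) := fun h => hk (by simp [hkj, mem_S, h])
      exact hM k hk' X fun Y hY => trace_mul_eq_zero_of_isComplementary (hA.2 hkj) hY hX hX0
  have inv : ∀ j ∈ S, ∀ k ∈ S, j ≠ k → ∃ p ∈ A j, p.conjTranspose = p ∧ p.trace = 0 ∧ p * p = 1 ∧
      ∀ i, p * e k i = e k i * p := by
    intro j hj k hk hjk
    obtain ⟨φ, hφ, -⟩ := hF j ((mem_S j).1 hj)
    obtain ⟨ψ, hψ, he⟩ := hF k ((mem_S k).1 hk)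
    obtain ⟨m, h1, h2, h3, h4⟩ := exists_involution_commuting φ ψ fun m n =>
      hA.2 hjk _ ((hφ _).2 ⟨m, rfl⟩) _ ((hψ _).2 ⟨n, rfl⟩)
    refine ⟨φ m, (hφ _).2 ⟨m, rfl⟩, ?_, ?_, ?_, fun i => by rw [he]; exact h4 i⟩
    · rw [← Matrix.star_eq_conjTranspose, ← map_star, Matrix.star_eq_conjTranspose, h1]
    · rw [trace_starAlgHom, h2, mul_zero]
    · rw [← map_mul, h3, map_one]
  have h1 : S.card ≠ 1 := by
    intro hc
    obtain ⟨j, hj⟩ := Finset.card_eq_one.1 hc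
    have hjS : j ∈ S := by simp [hj]
    obtain ⟨φ, hφ, he⟩ := hF j ((mem_S j).1 hjS)
    have := main j hjS (pauliTriple φ 0) ((hφ _).2 ⟨_, rfl⟩) (trace_pauliTriple φ 0)
    rw [hj, Finset.erase_singleton, Finset.sum_empty, eq_comm, smul_eq_zero] at this
    have h2 := trace_pauliTriple_mul φ 0 0
    simp [this.resolve_left (by norm_num)] at h2
  have h3 : S.card ≠ 3 := by
    intro hc
    obtain ⟨a, b, c, hab, hac, hbc, habc⟩ := Finset.card_eq_three.1 hc
    have ha : a ∈ S := by simp [habc]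
    have hb : b ∈ S := by simp [habc]
    have hc : c ∈ S := by simp [habc]
    have hmain : ∀ X ∈ A a, X.trace = 0 → twirl (e b) X + twirl (e c) X = (4 : ℂ) • X := by
      intro X hX hX0
      have := main a ha X hX hX0
      rwa [habc, Finset.erase_insert (by simp [hab, hac]), Finset.sum_pair hbc] at this
    obtain ⟨p, hpA, -, hp0, hpp, hpb⟩ := inv a ha b hb hab
    obtain ⟨q, hqA, -, hq0, hqq, hqc⟩ := inv a ha c hc hac
    have hcp : twirl (e c) p = 0 := by
      have := hmain p hpA hp0
      rwa [twirl_of_commute (hsq b ((mem_S b).1 hb)) hpb, add_eq_left] at this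
    have hbq : twirl (e b) q = 0 := by
      have := hmain q hqA hq0
      rwa [twirl_of_commute (hsq c ((mem_S c).1 hc)) hqc, add_eq_right] at this
    have hone : ∀ k ∈ S, ∀ z : ℂ, twirl (e k) (z • 1) = (4 * z) • 1 := by
      intro k hk z
      rw [twirl_of_commute (hsq k ((mem_S k).1 hk)) (by simp), smul_smul]
    -- The resolution needs a traceless argument, so the scalar part of `p * q` is removed. Both
    -- twirls kill `p * q` itself: `p` comes out of the first and `q` out of the second, leaving a
    -- twirl that is zero.
    have hr := hmain (p * q - ((p * q).trace / 4) • 1)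
      (sub_mem (mul_mem hpA hqA) ((A a).smul_mem (one_mem _) _)) (by
        simp [Matrix.trace_sub, Matrix.trace_smul])
    rw [twirl_sub, twirl_sub, twirl_mul_left hpb, twirl_mul_right hqc, hbq, hcp,
      hone b hb, hone c hc, mul_zero, zero_mul] at hr
    have hpq : p * q = (-((p * q).trace / 4)) • (1 : Matrix (Fin 4) (Fin 4) ℂ) := by
      linear_combination (norm := module) (-(1 / 4) : ℂ) • hr
    have htr : (p * q).trace = 0 := by
      have := congrArg Matrix.trace hpq
      rw [Matrix.trace_smul, Matrix.trace_one, Fintype.card_fin, smul_eq_mul] at this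
      push_cast at this
      linear_combination this / 2
    have hq : q = 0 := by
      rw [htr, zero_div, neg_zero, zero_smul] at hpq
      rw [← one_mul q, ← hpp, mul_assoc, hpq, mul_zero]
    simp [hq] at hqq
  have h5 : S.card ≠ 5 := by
    intro hc
    have hu : S = Finset.univ := Finset.eq_univ_of_card S (by simp [hc])
    have hall : ∀ k, k ∈ S := by simp [hu]
    choose p hpA hpc hp0 hpp hpe using fun k : Fin 4 =>
      inv 0 (hall _) k.succ (hall _) (Fin.succ_ne_zero k).symm
    have hmain : ∀ k, ∑ l : Fin 4, twirl (e l.succ) (p k) = (4 : ℂ) • p k := by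
      intro k
      rw [← main 0 (hall _) (p k) (hpA k) (hp0 k), hu,
        Finset.sum_erase_eq_sub (Finset.mem_univ _),
        Fin.sum_univ_succ (n := 4) (fun j => twirl (e j) (p k)), add_sub_cancel_left]
    -- Pairing the resolution with `p k`, the term `l = k` already accounts for the whole right
    -- side; the remaining terms are nonnegative and so vanish.
    have hz : ∀ k l, l ≠ k → twirl (e l.succ) (p k) = 0 := by
      intro k l hlk
      have hs := congrArg (fun Z => (p k * Z).trace) (hmain k)
      simp only [Finset.mul_sum, Matrix.trace_sum] at hs
      rw [← Finset.add_sum_erase _ _ (Finset.mem_univ k),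
        twirl_of_commute (hsq _ ((mem_S _).1 (hall _))) (hpe k), add_eq_left,
        Finset.sum_eq_zero_iff_of_nonneg] at hs
      · obtain ⟨φ, -, he⟩ := hF l.succ ((mem_S _).1 (hall _))
        have := hs l (by simp [hlk])
        rw [he] at this ⊢
        exact twirl_pauliTriple_eq_zero φ (hpc k) this
      · intro j _
        obtain ⟨φ, -, he⟩ := hF j.succ ((mem_S _).1 (hall _))
        rw [he]
        exact trace_mul_twirl_pauliTriple_nonneg φ (hpc k)
    obtain ⟨φ, hφ, -⟩ := hF 0 ((mem_S _).1 (hall _))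
    choose m hm using fun k => (hφ (p k)).1 (hpA k)
    have := card_le_three_of_trace_orthogonal m (fun k => by
      have := trace_starAlgHom φ (m k)
      rw [hm, hp0] at this
      simpa using this.symm) (fun k l => by
      have h2 := trace_starAlgHom φ (m k * m l)
      rw [map_mul, hm, hm] at h2
      split_ifs with hkl
      · subst hkl
        rw [hpp, Matrix.trace_one, Fintype.card_fin] at h2
        push_cast at h2
        linear_combination -h2 / 2
      -- Orthogonality: the twirl of index `l` multiplies the trace of `p k * p l` by four, yet it
      -- equals the zero matrix `twirl (e l.succ) (p k)` times `p l`.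
      · have h3 := trace_twirl (hsq l.succ ((mem_S _).1 (hall _))) (p k * p l)
        rw [twirl_mul_right (hpe l), hz k l (Ne.symm hkl), zero_mul, Matrix.trace_zero, h2] at h3
        linear_combination -h3 / 8)
    simp at this
  have hle : S.card ≤ 5 := (Finset.card_le_univ S).trans (by simp)
  rw [hS]
  simp only [Set.mem_insert_iff, Set.mem_singleton_iff]
  omega

/-! ### Subalgebras spanned by Pauli products -/

/-- The group law of the Pauli matrices modulo phases. -/
def pauliIndexMul : Fin 4 → Fin 4 → Fin 4 :=
  ![![0, 1, 2, 3], ![1, 0, 3, 2], ![2, 3, 0, 1], ![3, 2, 1, 0]]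

/-- Whether two Pauli matrices anticommute. -/
def PauliAnticommute (i j : Fin 4) : Prop :=
  i ≠ 0 ∧ j ≠ 0 ∧ i ≠ j

instance (i j : Fin 4) : Decidable (PauliAnticommute i j) :=
  inferInstanceAs (Decidable (_ ∧ _ ∧ _))

theorem exists_pauli_mul (i j : Fin 4) :
    ∃ c : ℂ, pauli i * pauli j = c • pauli (pauliIndexMul i j) := by
  have key : ∀ i j : Fin 4, pauli i * pauli j = (1 : ℂ) • pauli (pauliIndexMul i j) ∨
      pauli i * pauli j = Complex.I • pauli (pauliIndexMul i j) ∨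
      pauli i * pauli j = (-Complex.I) • pauli (pauliIndexMul i j) := by
    intro i j
    fin_cases i <;> fin_cases j <;>
      simp [pauli, pauliIndexMul, Matrix.smul_of, Matrix.smul_cons]
  rcases key i j with h | h | h <;> exact ⟨_, h⟩

theorem pauli_mul_comm (i j : Fin 4) :
    pauli i * pauli j = (if PauliAnticommute i j then (-1 : ℂ) else 1) • (pauli j * pauli i) := by
  fin_cases i <;> fin_cases j <;>
    simp [pauli, PauliAnticommute, Matrix.smul_cons]

theorem pauli_mul_self (i : Fin 4) : pauli i * pauli i = 1 := by
  ext a b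
  fin_cases i <;> fin_cases a <;> fin_cases b <;> simp [pauli]

theorem trace_pauli_mul (i j : Fin 4) : (pauli i * pauli j).trace = if i = j then 2 else 0 := by
  fin_cases i <;> fin_cases j <;> simp [pauli, Matrix.trace_fin_two] <;> norm_num

theorem pauliProd_mul (i j k l : Fin 4) : pauliProd i j * pauliProd k l =
    Matrix.reindex finProdFinEquiv finProdFinEquiv ((pauli i * pauli k) ⊗ₖ (pauli j * pauli l)) := by
  simp [pauliProd, Matrix.submatrix_mul_equiv, Matrix.mul_kronecker_mul]

theorem exists_pauliProd_mul (p q : Fin 4 × Fin 4) :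
    ∃ c : ℂ, pauliProd p.1 p.2 * pauliProd q.1 q.2 =
      c • pauliProd (pauliIndexMul p.1 q.1) (pauliIndexMul p.2 q.2) := by
  obtain ⟨c, hc⟩ := exists_pauli_mul p.1 q.1
  obtain ⟨d, hd⟩ := exists_pauli_mul p.2 q.2
  refine ⟨c * d, ?_⟩
  rw [pauliProd_mul, hc, hd, Matrix.smul_kronecker, Matrix.kronecker_smul, smul_smul]
  rfl

theorem pauliProd_mul_comm (p q : Fin 4 × Fin 4) :
    pauliProd p.1 p.2 * pauliProd q.1 q.2 =
      ((if PauliAnticommute p.1 q.1 then (-1 : ℂ) else 1) *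
        (if PauliAnticommute p.2 q.2 then (-1 : ℂ) else 1)) •
      (pauliProd q.1 q.2 * pauliProd p.1 p.2) := by
  rw [pauliProd_mul, pauliProd_mul, pauli_mul_comm p.1, pauli_mul_comm p.2, Matrix.smul_kronecker,
    Matrix.kronecker_smul, smul_smul]
  rfl

theorem pauliProd_zero : pauliProd 0 0 = 1 := by
  simp [pauliProd, pauli_zero]

theorem pauliProd_mul_self (i j : Fin 4) : pauliProd i j * pauliProd i j = 1 := by
  rw [pauliProd_mul, pauli_mul_self, pauli_mul_self]
  simp

theorem conjTranspose_pauliProd (i j : Fin 4) :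
    (pauliProd i j).conjTranspose = pauliProd i j := by
  rw [pauliProd, Matrix.conjTranspose_reindex, Matrix.conjTranspose_kronecker, pauli_conjTranspose,
    pauli_conjTranspose]

theorem trace_pauliProd_mul (p q : Fin 4 × Fin 4) :
    (pauliProd p.1 p.2 * pauliProd q.1 q.2).trace = if p = q then 4 else 0 := by
  have : ∀ M : Matrix (Fin 2 × Fin 2) (Fin 2 × Fin 2) ℂ,
      (Matrix.reindex finProdFinEquiv finProdFinEquiv M).trace = M.trace := fun M =>
    (finProdFinEquiv (m := 2) (n := 2)).symm.sum_comp fun i => M i i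
  rw [pauliProd_mul, this, Matrix.trace_kronecker, trace_pauli_mul, trace_pauli_mul]
  by_cases h1 : p.1 = q.1 <;> by_cases h2 : p.2 = q.2 <;> simp [h1, h2, Prod.ext_iff]
  norm_num

theorem linearIndependent_pauliProd :
    LinearIndependent ℂ (fun p : Fin 4 × Fin 4 => pauliProd p.1 p.2) := by
  rw [Fintype.linearIndependent_iff]
  intro g hg q
  have := congrArg (fun X => (X * pauliProd q.1 q.2).trace) hg
  simp only [Finset.sum_mul, Matrix.trace_sum, Matrix.smul_mul, Matrix.trace_smul,
    trace_pauliProd_mul] at this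
  simpa using this

/-- The span of a subgroup of the Pauli group modulo phases. -/
noncomputable def pauliSubalgebra (S : Finset (Fin 4 × Fin 4)) (h0 : (0, 0) ∈ S)
    (hS : ∀ p ∈ S, ∀ q ∈ S, (pauliIndexMul p.1 q.1, pauliIndexMul p.2 q.2) ∈ S) :
    StarSubalgebra ℂ (Matrix (Fin 4) (Fin 4) ℂ) where
  toSubalgebra := Submodule.toSubalgebra
    (Submodule.span ℂ ((fun p : Fin 4 × Fin 4 => pauliProd p.1 p.2) '' S))
    (Submodule.subset_span ⟨(0, 0), h0, pauliProd_zero⟩) (by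
      intro X Y hX hY
      refine Submodule.span_induction₂ (p := fun X Y _ _ => X * Y ∈
        Submodule.span ℂ ((fun p : Fin 4 × Fin 4 => pauliProd p.1 p.2) '' S))
        ?_ ?_ ?_ ?_ ?_ ?_ ?_ hX hY
      · rintro _ _ ⟨p, hp, rfl⟩ ⟨q, hq, rfl⟩
        obtain ⟨c, hc⟩ := exists_pauliProd_mul p q
        rw [hc]
        exact Submodule.smul_mem _ _ (Submodule.subset_span ⟨_, hS p hp q hq, rfl⟩)
      · simp
      · simp
      · intro x y z _ _ _ h1 h2
        rw [add_mul]
        exact add_mem h1 h2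
      · intro x y z _ _ _ h1 h2
        rw [mul_add]
        exact add_mem h1 h2
      · intro r x y _ _ h
        rw [smul_mul_assoc]
        exact Submodule.smul_mem _ _ h
      · intro r x y _ _ h
        rw [mul_smul_comm]
        exact Submodule.smul_mem _ _ h)
  star_mem' {X} hX := by
    refine Submodule.span_induction (p := fun X _ => star X ∈
      Submodule.span ℂ ((fun p : Fin 4 × Fin 4 => pauliProd p.1 p.2) '' S)) ?_ ?_ ?_ ?_ hX
    · rintro _ ⟨p, hp, rfl⟩
      rw [Matrix.star_eq_conjTranspose, conjTranspose_pauliProd]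
      exact Submodule.subset_span ⟨p, hp, rfl⟩
    · simp
    · intro x y _ _ h1 h2
      rw [star_add]
      exact add_mem h1 h2
    · intro r x _ h
      rw [star_smul]
      exact Submodule.smul_mem _ _ h

section

variable {S T : Finset (Fin 4 × Fin 4)} {h0 : (0, 0) ∈ S} {h0' : (0, 0) ∈ T}
  {hS : ∀ p ∈ S, ∀ q ∈ S, (pauliIndexMul p.1 q.1, pauliIndexMul p.2 q.2) ∈ S}
  {hT : ∀ p ∈ T, ∀ q ∈ T, (pauliIndexMul p.1 q.1, pauliIndexMul p.2 q.2) ∈ T}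

theorem toSubmodule_pauliSubalgebra :
    Subalgebra.toSubmodule (pauliSubalgebra S h0 hS).toSubalgebra =
      Submodule.span ℂ ((fun p : Fin 4 × Fin 4 => pauliProd p.1 p.2) '' S) :=
  Submodule.toSubalgebra_toSubmodule _ _ _

theorem mem_pauliSubalgebra {X : Matrix (Fin 4) (Fin 4) ℂ} : X ∈ pauliSubalgebra S h0 hS ↔
    X ∈ Submodule.span ℂ ((fun p : Fin 4 × Fin 4 => pauliProd p.1 p.2) '' S) := Iff.rfl

theorem isPauliSpanned_pauliSubalgebra : IsPauliSpanned (pauliSubalgebra S h0 hS) :=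
  ⟨S, toSubmodule_pauliSubalgebra⟩

theorem finrank_pauliSubalgebra :
    Module.finrank ℂ (Subalgebra.toSubmodule (pauliSubalgebra S h0 hS).toSubalgebra) = S.card := by
  rw [toSubmodule_pauliSubalgebra, Set.image_eq_range]
  have := finrank_span_eq_card
    (linearIndependent_pauliProd.comp (fun p : S => (p : Fin 4 × Fin 4)) Subtype.val_injective)
  rw [Fintype.card_coe] at this
  exact this

/-- Distinct Pauli products are trace-orthogonal, so by bilinearity only the shared identity
contributes. -/
theorem isComplementary_pauliSubalgebra (hST : ∀ p ∈ S, ∀ q ∈ T, p = q → p = (0, 0)) :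
    IsComplementary (pauliSubalgebra S h0 hS) (pauliSubalgebra T h0' hT) := by
  intro X hX Y hY
  rw [mem_pauliSubalgebra] at hX hY
  refine Submodule.span_induction₂ (p := fun X Y _ _ =>
    normTrace (X * Y) = normTrace X * normTrace Y) ?_ ?_ ?_ ?_ ?_ ?_ ?_ hX hY
  · rintro _ _ ⟨p, hp, rfl⟩ ⟨q, hq, rfl⟩
    have h1 : ∀ p : Fin 4 × Fin 4, (pauliProd p.1 p.2).trace = if p = (0, 0) then 4 else 0 := by
      intro p
      rw [← trace_pauliProd_mul p (0, 0), pauliProd_zero, mul_one]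
    simp only [normTrace, trace_pauliProd_mul, h1]
    by_cases hpq : p = q
    · have := hST p hp q hq hpq
      subst hpq
      simp [this]
    · have : ¬ (p = (0, 0) ∧ q = (0, 0)) := fun h => hpq (h.1.trans h.2.symm)
      by_cases h : p = (0, 0) <;> simp_all
  · simp [normTrace]
  · simp [normTrace]
  · intro x y z _ _ _ h1 h2
    simp only [normTrace, add_mul, Matrix.trace_add, add_div] at *
    rw [h1, h2]
  · intro x y z _ _ _ h1 h2
    simp only [normTrace, mul_add, Matrix.trace_add, add_div] at *
    rw [h1, h2]
  · intro r x y _ _ h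
    simp only [normTrace, smul_mul_assoc, Matrix.trace_smul, smul_eq_mul, mul_div_assoc,
      mul_assoc] at *
    rw [h]
  · intro r x y _ _ h
    simp only [normTrace, mul_smul_comm, Matrix.trace_smul, smul_eq_mul, mul_div_assoc] at *
    rw [h]
    ring

/-- Two Pauli products commute exactly when neither or both of their tensor factors anticommute,
which is what `hc` records. -/
theorem isMSubalgebra_pauliSubalgebra (hcard : S.card = 4)
    (hc : ∀ p ∈ S, ∀ q ∈ S, PauliAnticommute p.1 q.1 ↔ PauliAnticommute p.2 q.2) :
    IsMSubalgebra (pauliSubalgebra S h0 hS) := by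
  refine isMSubalgebra_of_finrank_eq_four (fun X hX Y hY => ?_)
    (finrank_pauliSubalgebra.trans hcard)
  rw [mem_pauliSubalgebra] at hX hY
  refine Submodule.span_induction₂ (p := fun X Y _ _ => X * Y = Y * X) ?_ ?_ ?_ ?_ ?_ ?_ ?_ hX hY
  · rintro _ _ ⟨p, hp, rfl⟩ ⟨q, hq, rfl⟩
    have := hc p hp q hq
    rw [pauliProd_mul_comm]
    split_ifs <;> simp_all
  · simp
  · simp
  · intro x y z _ _ _ h1 h2
    rw [add_mul, mul_add, h1, h2]
  · intro x y z _ _ _ h1 h2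
    rw [add_mul, mul_add, h1, h2]
  · intro r x y _ _ h
    rw [smul_mul_assoc, mul_smul_comm, h]
  · intro r x y _ _ h
    rw [smul_mul_assoc, mul_smul_comm, h]

end

/-! ### Recognizing F-subalgebras -/

/-- Two anticommuting Hermitian involutions define a representation of `M_2(ℂ)`. -/
theorem exists_starAlgHom_of_anticommute {a b : Matrix (Fin 4) (Fin 4) ℂ}
    (ha : a.conjTranspose = a) (hb : b.conjTranspose = b) (haa : a * a = 1) (hbb : b * b = 1)
    (hab : a * b = -(b * a)) :
    ∃ φ : Matrix (Fin 2) (Fin 2) ℂ →⋆ₐ[ℂ] Matrix (Fin 4) (Fin 4) ℂ,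
      ∀ m, φ m = ((m 0 0 + m 1 1) / 2) • (1 : Matrix (Fin 4) (Fin 4) ℂ) +
        ((m 0 1 + m 1 0) / 2) • a + (Complex.I * (m 0 1 - m 1 0) / 2) • b +
        (-Complex.I * (m 0 0 - m 1 1) / 2) • (a * b) := by
  have hI := Complex.I_mul_I
  have h1 : a * (a * b) = b := by rw [← mul_assoc, haa, one_mul]
  have h2 : b * (a * b) = -a := by rw [hab, mul_neg, ← mul_assoc, hbb, one_mul]
  have h3 : (a * b) * a = -b := by rw [hab, neg_mul, mul_assoc, haa, mul_one]
  have h4 : (a * b) * b = a := by rw [mul_assoc, hbb, mul_one]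
  have h5 : (a * b) * (a * b) = -1 := by rw [mul_assoc, h2, mul_neg, haa]
  have h6 : b * a = -(a * b) := by rw [hab, neg_neg]
  -- The images of $\sigma_1, \sigma_2, \sigma_3$ are $a$, $b$, $-iab$; the scalars are the Pauli
  -- coefficients of `m`.
  refine ⟨
    { toFun := fun m => ((m 0 0 + m 1 1) / 2) • (1 : Matrix (Fin 4) (Fin 4) ℂ) +
        ((m 0 1 + m 1 0) / 2) • a + (Complex.I * (m 0 1 - m 1 0) / 2) • b +
        (-Complex.I * (m 0 0 - m 1 1) / 2) • (a * b)
      map_one' := by simp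
      map_zero' := by simp
      map_add' := fun m n => by
        simp only [Matrix.add_apply]
        module
      map_mul' := fun m n => by
        simp only [add_mul, mul_add, smul_mul_smul_comm, mul_one, one_mul, h1, h2, h3, h4, h5, haa,
          hbb, h6, Matrix.mul_apply, Fin.sum_univ_two]
        match_scalars <;> ring_nf <;> simp only [Complex.I_sq] <;> ring
      commutes' := fun r => by
        simp [Algebra.algebraMap_eq_smul_one]
      map_star' := fun m => by
        have e : (a * b).conjTranspose = -(a * b) := by rw [Matrix.conjTranspose_mul, ha, hb, h6]
        simp only [Matrix.star_eq_conjTranspose, Matrix.conjTranspose_smul, ha, hb, e, Matrix.conjTranspose_one,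
          Matrix.conjTranspose_apply, star_div₀, star_add, star_mul', star_sub, star_neg,
          RCLike.star_def, Complex.conj_I, map_ofNat]
        module }, fun m => rfl⟩

theorem starAlgHom_injective
    (φ : Matrix (Fin 2) (Fin 2) ℂ →⋆ₐ[ℂ] Matrix (Fin 4) (Fin 4) ℂ) : Function.Injective φ :=
  RingHom.injective φ.toAlgHom.toRingHom

/-- The representation generated by `a` and `b` is injective because $M_2(\mathbb C)$ is simple, so
its range fills `A` by dimension. -/
theorem isFSubalgebra_of_anticommute {A : StarSubalgebra ℂ (Matrix (Fin 4) (Fin 4) ℂ)}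
    (hd : Module.finrank ℂ (Subalgebra.toSubmodule A.toSubalgebra) = 4)
    {a b : Matrix (Fin 4) (Fin 4) ℂ} (haA : a ∈ A) (hbA : b ∈ A)
    (ha : a.conjTranspose = a) (hb : b.conjTranspose = b) (haa : a * a = 1) (hbb : b * b = 1)
    (hab : a * b = -(b * a)) : IsFSubalgebra A := by
  obtain ⟨φ, hφ⟩ := exists_starAlgHom_of_anticommute ha hb haa hbb hab
  have hinj := starAlgHom_injective φ
  have hle : LinearMap.range φ.toAlgHom.toLinearMap ≤ Subalgebra.toSubmodule A.toSubalgebra := by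
    rintro _ ⟨m, rfl⟩
    change φ m ∈ A
    rw [hφ]
    exact add_mem (add_mem (add_mem (A.smul_mem (one_mem _) _) (A.smul_mem haA _))
      (A.smul_mem hbA _)) (A.smul_mem (mul_mem haA hbA) _)
  have heq := Submodule.eq_of_le_of_finrank_eq hle (by
    rw [hd, LinearMap.finrank_range_of_inj hinj]
    simp [Module.finrank_matrix])
  have hA : φ.range = A := by
    ext X
    exact SetLike.ext_iff.1 heq X
  subst hA
  exact ⟨(StarAlgEquiv.ofInjective φ hinj).symm⟩

/-- Needed for the exact count: commutative subgroups must not be counted as F-subalgebras. -/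
theorem IsMSubalgebra.not_isFSubalgebra {A : StarSubalgebra ℂ (Matrix (Fin 4) (Fin 4) ℂ)}
    (hA : IsMSubalgebra A) : ¬ IsFSubalgebra A := by
  intro hF
  obtain ⟨φ, hφ⟩ := hF.exists_starAlgHom
  have h := hA.prop _ ((hφ _).2 ⟨pauli 1, rfl⟩) _ ((hφ _).2 ⟨pauli 2, rfl⟩)
  rw [← map_mul, ← map_mul] at h
  have h' := congrFun (congrFun (starAlgHom_injective φ h) 0) 0
  simp [pauli, Complex.ext_iff] at h'
  norm_num at h'

theorem isFSubalgebra_pauliSubalgebra {S : Finset (Fin 4 × Fin 4)} {h0 : (0, 0) ∈ S}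
    {hS : ∀ p ∈ S, ∀ q ∈ S, (pauliIndexMul p.1 q.1, pauliIndexMul p.2 q.2) ∈ S}
    (hcard : S.card = 4)
    (hc : ∃ p ∈ S, ∃ q ∈ S, ¬ (PauliAnticommute p.1 q.1 ↔ PauliAnticommute p.2 q.2)) :
    IsFSubalgebra (pauliSubalgebra S h0 hS) := by
  obtain ⟨p, hp, q, hq, h⟩ := hc
  refine isFSubalgebra_of_anticommute (finrank_pauliSubalgebra.trans hcard)
    (Submodule.subset_span ⟨p, hp, rfl⟩) (Submodule.subset_span ⟨q, hq, rfl⟩)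
    (conjTranspose_pauliProd _ _) (conjTranspose_pauliProd _ _) (pauliProd_mul_self _ _)
    (pauliProd_mul_self _ _) ?_
  rw [pauliProd_mul_comm]
  split_ifs <;> simp_all

/-- Five subgroups of order four of the Pauli group modulo phases which meet trivially span a
complementary decomposition, whose F-subalgebras come from the noncommutative subgroups. -/
theorem exists_pauliSpanned_decomposition (S : Fin 5 → Finset (Fin 4 × Fin 4))
    (h0 : ∀ k, (0, 0) ∈ S k)
    (hS : ∀ k, ∀ p ∈ S k, ∀ q ∈ S k, (pauliIndexMul p.1 q.1, pauliIndexMul p.2 q.2) ∈ S k)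
    (hcard : ∀ k, (S k).card = 4)
    (hST : ∀ j k, j ≠ k → ∀ p ∈ S j, ∀ q ∈ S k, p = q → p = (0, 0)) :
    ∃ A : Fin 5 → StarSubalgebra ℂ (Matrix (Fin 4) (Fin 4) ℂ),
      IsComplementaryDecomposition A ∧ (∀ k, IsPauliSpanned (A k)) ∧
      {k : Fin 5 | IsFSubalgebra (A k)}.ncard = (Finset.univ.filter fun k => ∃ p ∈ S k, ∃ q ∈ S k,
        ¬ (PauliAnticommute p.1 q.1 ↔ PauliAnticommute p.2 q.2)).card := by
  have hM : ∀ k, (¬ ∃ p ∈ S k, ∃ q ∈ S k,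
      ¬ (PauliAnticommute p.1 q.1 ↔ PauliAnticommute p.2 q.2)) →
      IsMSubalgebra (pauliSubalgebra (S k) (h0 k) (hS k)) := by
    intro k hk
    push Not at hk
    exact isMSubalgebra_pauliSubalgebra (hcard k) hk
  refine ⟨fun k => pauliSubalgebra (S k) (h0 k) (hS k), ⟨fun k => ?_, fun j k hjk =>
    isComplementary_pauliSubalgebra (hST j k hjk)⟩, fun k => isPauliSpanned_pauliSubalgebra, ?_⟩
  · by_cases hk : ∃ p ∈ S k, ∃ q ∈ S k,
      ¬ (PauliAnticommute p.1 q.1 ↔ PauliAnticommute p.2 q.2)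
    · exact Or.inl (isFSubalgebra_pauliSubalgebra (hcard k) hk)
    · exact Or.inr (hM k hk)
  · rw [← Set.ncard_coe_finset]
    congr 1
    ext k
    simp only [Finset.coe_filter, Finset.mem_univ, true_and]
    exact ⟨fun h => by_contra fun hk => (hM k hk).not_isFSubalgebra h,
      fun hk => isFSubalgebra_pauliSubalgebra (hcard k) hk⟩

theorem mainTheorem4 :
    (∀ A : Fin 5 → StarSubalgebra ℂ (Matrix (Fin 4) (Fin 4) ℂ),
      IsComplementaryDecomposition A →
        {k : Fin 5 | IsFSubalgebra (A k)}.ncard ∈ ({0, 2, 4} : Set ℕ)) ∧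
    (∀ l ∈ ({0, 2, 4} : Set ℕ),
      ∃ A : Fin 5 → StarSubalgebra ℂ (Matrix (Fin 4) (Fin 4) ℂ),
        IsComplementaryDecomposition A ∧
        (∀ k, IsPauliSpanned (A k)) ∧
        {k : Fin 5 | IsFSubalgebra (A k)}.ncard = l) := by
  refine ⟨fun A hA => hA.ncard_mem, ?_⟩
  rintro l (rfl | rfl | rfl)
  -- All five subgroups are commutative here. The next choice has the two tensor factors as its
  -- noncommutative ones; in the last, only the third subgroup is commutative. The counts hold by
  -- evaluation.
  · exact exists_pauliSpanned_decomposition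
      ![{(0, 0), (0, 1), (1, 0), (1, 1)}, {(0, 0), (0, 2), (2, 0), (2, 2)},
        {(0, 0), (0, 3), (3, 0), (3, 3)}, {(0, 0), (1, 2), (2, 3), (3, 1)},
        {(0, 0), (1, 3), (2, 1), (3, 2)}]
      (by decide) (by decide) (by decide) (by decide)
  · exact exists_pauliSpanned_decomposition
      ![{(0, 0), (1, 0), (2, 0), (3, 0)}, {(0, 0), (0, 1), (0, 2), (0, 3)},
        {(0, 0), (1, 1), (2, 2), (3, 3)}, {(0, 0), (1, 2), (2, 3), (3, 1)},
        {(0, 0), (1, 3), (2, 1), (3, 2)}]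
      (by decide) (by decide) (by decide) (by decide)
  · exact exists_pauliSpanned_decomposition
      ![{(0, 0), (0, 1), (2, 2), (2, 3)}, {(0, 0), (0, 2), (1, 1), (1, 3)},
        {(0, 0), (0, 3), (3, 0), (3, 3)}, {(0, 0), (1, 0), (2, 1), (3, 1)},
        {(0, 0), (1, 2), (2, 0), (3, 2)}]
      (by decide) (by decide) (by decide) (by decide)
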